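/- Let $k\ge 1$ be an integer and let $L$ be a positive definite, even, unimodular lattice of dimension (rank) $24k$; that is, $L$ is a free abelian group of rank $24k$ with a symmetric bilinear form $\langle\cdot,\cdot\rangle : L\times L\to\mathbb Z$ such that $\langle \ell,\ell\rangle$ is positive for all $\ell\neq 0$ and even for all $\ell$, and such that $\ell\mapsto\langle \ell,\cdot\rangle$ is an isomorphism $L\to\operatorname{Hom}(L,\mathbb Z)$. In $\mathbb Z[[q]]$ put \[ \theta_L=\sum_{n\ge 0}\#\{\ell\in L : \langle \ell,\ell\rangle=2n\}\,q^n,\qquad c_4=1+240\sum_{n\ge 1}\sigma_3(n)q^n,\qquad \Delta=q\prod_{n\ge 1}(1-q^n)^{24}, \] where $\sigma_3(n)=\sum_{d\mid n}d^3$. Then there are unique integers $x_1,\dots,x_k$ with \[ \theta_L=c_4^{3k}+x_1c_4^{3(k-1)}\Delta+\dots+x_k\Delta^k, \] and they satisfy $x_k\equiv 0 \pmod{24}$. -/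

import Mathlib

open scoped PowerSeries ArithmeticFunction.sigma

noncomputable section

namespace BorcherdsCongruence

/-- An integral symmetric bilinear form on a free abelian group `L` of finite rank makes `L` a
positive definite, even, unimodular lattice. -/
structure IsPosDefEvenUnimodular {L : Type*} [AddCommGroup L] (B : LinearMap.BilinForm ℤ L) :
    Prop where
  symm : ∀ x y, B x y = B y x
  pos_def : ∀ x, x ≠ 0 → 0 < B x x
  even : ∀ x, Even (B x x)
  /-- The map `x ↦ ⟨x, ·⟩` is an isomorphism of `L` onto its dual `Hom(L, ℤ)`. -/
  unimodular : Function.Bijective (fun x : L => B x)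

/-- The theta series `∑ₙ Lₙ qⁿ`, where `Lₙ` is the number of `ℓ` with `⟨ℓ, ℓ⟩ = 2 n`. -/
def theta {L : Type*} [AddCommGroup L] (B : LinearMap.BilinForm ℤ L) : ℤ⟦X⟧ :=
  PowerSeries.mk fun n => (Set.ncard {l : L | B l l = 2 * (n : ℤ)} : ℤ)

/-- The sets counted by the theta series are finite. -/
theorem IsPosDefEvenUnimodular.finite_shell {L : Type*} [AddCommGroup L] [Module.Free ℤ L]
    [Module.Finite ℤ L] {B : LinearMap.BilinForm ℤ L} (hB : IsPosDefEvenUnimodular B) (m : ℤ) :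
    {l : L | B l l = m}.Finite := by
  classical
  let b := Module.Free.chooseBasis ℤ L
  have hnn : ∀ x, 0 ≤ B x x := fun x => by
    by_cases hx : x = 0
    · simp [hx]
    · exact (hB.pos_def x hx).le
  choose v hv using fun i => hB.unimodular.2 (b.coord i)
  let C : Module.Free.ChooseBasisIndex ℤ L → ℤ := fun i => B (v i) (v i) * m
  have hfin : (Set.pi Set.univ fun i => Set.Icc (-(C i)) (C i)).Finite :=
    Set.Finite.pi fun i => Set.finite_Icc _ _
  refine Set.Finite.of_finite_image (f := fun l i => b.repr l i) (hfin.subset ?_) ?_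
  · rintro _ ⟨l, hl, rfl⟩ i -
    have h1 : B (v i) l = b.repr l i := by
      have := hv i
      simp only at this
      rw [this, Module.Basis.coord_apply]
    have h2 := LinearMap.BilinForm.apply_sq_le_of_symm B hnn ⟨hB.symm⟩ (v i) l
    have hl' : B l l = m := hl
    rw [h1, hl'] at h2
    constructor <;> simp only [C] <;> nlinarith [sq_nonneg (b.repr l i), Int.le_self_sq (b.repr l i),
      Int.le_self_sq (-(b.repr l i))]
  · intro x _ y _ hxy
    exact b.repr.injective (Finsupp.ext fun i => congrFun hxy i)

/-- `c₄ = 1 + 240 ∑_{n > 0} σ₃(n) qⁿ`; note that `σ₃(0) = 0` in Mathlib. -/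
def c₄ : ℤ⟦X⟧ :=
  1 + 240 * PowerSeries.mk fun n => (σ 3 n : ℤ)

section

open scoped PowerSeries.WithPiTopology

/-- `Δ = q ∏_{n ≥ 1} (1 - qⁿ)²⁴`, an infinite product of formal power series for the topology of
coefficientwise convergence. -/
def Δ : ℤ⟦X⟧ :=
  PowerSeries.X * ∏' n : ℕ, (1 - PowerSeries.X ^ (n + 1)) ^ 24

/-- The infinite product that defines `Δ` converges. -/
theorem multipliable_Δ :
    Multipliable fun n : ℕ => (1 - PowerSeries.X ^ (n + 1) : ℤ⟦X⟧) ^ 24 :=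
  (PowerSeries.WithPiTopology.multipliable_one_sub_X_pow ℤ).pow 24

end

end BorcherdsCongruence

end

/-! Write ct for the constant term of a Laurent series in `q`. Since `Δ = X * U` with `U` a unit
over `ℤ`, whose inverse is called `V`, ct(f/Δ^k) is the coefficient of `X ^ k` in `f * V ^ k`.

Existence and integrality of the xᵢ: by Poisson summation θ is a modular form of weight 12k and
level one. Subtracting an integer multiple of c₄^(3k) and dividing by Δ lowers the weight by 12 and
keeps integral coefficients (`exists_homogSum_eq`). Uniqueness holds because successive terms have
increasing order of vanishing.

The congruence compares two constant terms modulo 24. On one side, ct(θ/Δ^k) ≡ x_k: modulo 24 both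
c₄ and E₂ are 1, so ct(c₄^(3m)/Δ^m) ≡ ct(E₂/Δ^m), and this is 0 for m ≥ 1 because D(Δ^(-m)) = -m E₂
Δ^(-m) for D = q d/dq (`coeff_pow_mem_span_twentyFour`, `coeff_homogSum_mul_pow`).

On the other side, 24 divides ct(θ/Δ^k) (`dvd_coeff_theta_mul_pow`). The series Σ⟨l,v⟩² q^(⟨l,l⟩/2)
- (⟨v,v⟩/12) E₂ θ is modular of weight 12k+2 (`exists_modularForm_quadSum`), so its quotient by Δ^k
has constant term 0 (`coeff_qExpansion_mul_pow_eq_zero`). Polarising, 12 ct(Σ⟨l,v⟩⟨l,w⟩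
q^(⟨l,l⟩/2)/Δ^k) = ⟨v,w⟩ ct(E₂θ/Δ^k). Unimodularity supplies ⟨v,w⟩ = 1, and pairing l with -l makes
the weighted series even. Hence 24 divides ct(E₂θ/Δ^k), and E₂ ≡ 1 modulo 24. -/

noncomputable section

namespace BorcherdsCongruence

/-! ### Constant terms of quotients by powers of `X * U`, formally -/

section Formal

open PowerSeries

/-- The derivation `q d/dq` of the ring of power series in `q`. -/
def qDeriv (R : Type*) [CommRing R] : Derivation R R⟦X⟧ R⟦X⟧ :=
  (X : R⟦X⟧) • PowerSeries.derivative R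

variable {R : Type*} [CommRing R]

theorem coeff_qDeriv (f : R⟦X⟧) (n : ℕ) : coeff n (qDeriv R f) = n * coeff n f := by
  rw [qDeriv, Derivation.smul_apply, smul_eq_mul]
  cases n with
  | zero => simp
  | succ n => rw [coeff_succ_X_mul, coeff_derivative, mul_comm]; push_cast; rfl

theorem qDeriv_map {S : Type*} [CommRing S] (φ : R →+* S) (f : R⟦X⟧) :
    qDeriv S (PowerSeries.map φ f) = PowerSeries.map φ (qDeriv R f) := by
  ext n
  simp [coeff_qDeriv]

theorem constantCoeff_map {S : Type*} [CommRing S] (φ : R →+* S) (f : R⟦X⟧) :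
    constantCoeff (PowerSeries.map φ f) = φ (constantCoeff f) := by
  rw [← coeff_zero_eq_constantCoeff_apply, coeff_map, coeff_zero_eq_constantCoeff_apply]

/-- If `XU` is an eigenvector of `q d/dq` up to the factor `E`, then the coefficient of `X ^ k` in
`(q f' - k E f) / U ^ k`, that is, the constant term of the `q`-derivative of `f / (XU) ^ k`,
vanishes. -/
theorem coeff_qDeriv_sub_mul_pow {U V E : R⟦X⟧} (hUV : U * V = 1)
    (hD : qDeriv R (X * U) = E * (X * U)) (k : ℕ) (f : R⟦X⟧) :
    coeff k ((qDeriv R f - (k : R⟦X⟧) * E * f) * V ^ k) = 0 := by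
  have hX : qDeriv R (X : R⟦X⟧) = X := by simp [qDeriv]
  have hU : qDeriv R U = (E - 1) * U := by
    rw [Derivation.leibniz, hX, smul_eq_mul, smul_eq_mul] at hD
    have h : X * qDeriv R U = X * ((E - 1) * U) := by linear_combination hD
    exact X_mul_cancel h
  have hV : qDeriv R V = (1 - E) * V := by
    have h := congrArg (qDeriv R) hUV
    rw [Derivation.leibniz, hU, Derivation.map_one_eq_zero, smul_eq_mul, smul_eq_mul] at h
    linear_combination V * h + ((1 - E) * V - qDeriv R V) * hUV
  have hVk : qDeriv R (V ^ k) = (k : R⟦X⟧) * (1 - E) * V ^ k := by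
    rw [Derivation.leibniz_pow, hV]
    cases k with
    | zero => simp
    | succ k => simp only [smul_eq_mul, nsmul_eq_mul, Nat.add_sub_cancel]; ring
  -- Dropping the factor `X ^ (-k)` from `(X * U) ^ (-k)` turns the derivation D into D - k, which
  -- annihilates the coefficient of `X ^ k`.
  have h : (qDeriv R f - (k : R⟦X⟧) * E * f) * V ^ k = qDeriv R (f * V ^ k) - (k : R⟦X⟧) * (f * V ^ k) := by
    rw [Derivation.leibniz, hVk, smul_eq_mul, smul_eq_mul]
    ring
  rw [h, map_sub, coeff_qDeriv, ← map_natCast (C (R := R)), coeff_C_mul, sub_self]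

theorem coeff_mul_pow_succ {U V : R⟦X⟧} (hUV : U * V = 1) (k : ℕ) (f : R⟦X⟧) :
    coeff (k + 1) (X * U * f * V ^ (k + 1)) = coeff k (f * V ^ k) := by
  rw [show X * U * f * V ^ (k + 1) = X * (f * V ^ k) by linear_combination X * f * V ^ k * hUV,
    coeff_succ_X_mul]

/-- The sum `∑ᵢ xᵢ c ^ (3 (k - i)) d ^ i` for `0 ≤ i ≤ k`. -/
def homogSum (c d : R⟦X⟧) (k : ℕ) (x : Fin (k + 1) → R) : R⟦X⟧ :=
  ∑ i : Fin (k + 1), C (x i) * c ^ (3 * (k - (i : ℕ))) * d ^ (i : ℕ)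

theorem homogSum_succ (c d : R⟦X⟧) (k : ℕ) (x : Fin (k + 2) → R) :
    homogSum c d (k + 1) x =
      C (x 0) * c ^ (3 * (k + 1)) + d * homogSum c d k (fun i => x i.succ) := by
  rw [homogSum, Fin.sum_univ_succ, homogSum, Finset.mul_sum]
  congr 1
  · simp
  · refine Finset.sum_congr rfl fun i _ => ?_
    simp only [Fin.val_succ, Nat.add_sub_add_right, pow_succ]
    ring

theorem constantCoeff_homogSum {c d : R⟦X⟧} (hc : constantCoeff c = 1)
    (hd : constantCoeff d = 0) (k : ℕ) (x : Fin (k + 1) → R) :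
    constantCoeff (homogSum c d k x) = x 0 := by
  cases k with
  | zero => simp [homogSum]
  | succ k => simp [homogSum_succ, hc, hd]

/-- Triangularity: the constant term recovers `x 0`, and what remains is divisible by `d`. -/
theorem homogSum_injective [IsDomain R] {c d : R⟦X⟧} (hc : constantCoeff c = 1)
    (hd : constantCoeff d = 0) (hd0 : d ≠ 0) (k : ℕ) :
    Function.Injective (homogSum c d k) := by
  have h0 := constantCoeff_homogSum hc hd
  induction k with
  | zero =>
    intro x y hxy
    ext i
    rw [Fin.fin_one_eq_zero i, ← h0 0 x, hxy, h0]
  | succ k ih =>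
    intro x y hxy
    have hxy0 : x 0 = y 0 := by rw [← h0 _ x, hxy, h0]
    rw [homogSum_succ, homogSum_succ, hxy0, add_right_inj] at hxy
    have := ih (mul_left_cancel₀ hd0 hxy)
    ext i
    exact Fin.cases hxy0 (fun i => congrFun this i) i

/-- The i-th term contributes `x i` times the constant term of (c³/(XU))^(k-i). All of these lie in
`I` except the one for i = k, which is the last coordinate itself. -/
theorem coeff_homogSum_mul_pow {U V c : R⟦X⟧} (hUV : U * V = 1) (k : ℕ) (x : Fin (k + 1) → R)
    {I : Ideal R} (hc : ∀ m, coeff (m + 1) (c ^ (3 * (m + 1)) * V ^ (m + 1)) ∈ I) :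
    coeff k (homogSum c (X * U) k x * V ^ k) - x (Fin.last k) ∈ I := by
  induction k with
  | zero => simp [homogSum]
  | succ k ih =>
    rw [homogSum_succ, add_mul, map_add, coeff_mul_pow_succ hUV, add_sub_assoc, mul_assoc,
      coeff_C_mul]
    exact I.add_mem (I.mul_mem_left _ (hc k)) (ih _)

end Formal

/-- `E₂ = 1 - 24 ∑_{n ≥ 1} σ₁(n) qⁿ`. -/
def c₂ : ℤ⟦X⟧ :=
  1 - 24 * PowerSeries.mk fun n => (σ 1 n : ℤ)

/-! ### Powers of c₄ modulo 24 -/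

section Congruence

open PowerSeries

/-- Modulo 24 the power of `c₄` can be replaced by `c₂`, since both are 1. After that the quotient
is, up to the nonzero factor -(m+1), a `q`-derivative, which has no constant term. -/
theorem coeff_pow_mem_span_twentyFour {U V : ℤ⟦X⟧} (hUV : U * V = 1)
    (hD : qDeriv ℤ (X * U) = c₂ * (X * U)) (m : ℕ) :
    coeff (m + 1) (c₄ ^ (3 * (m + 1)) * V ^ (m + 1)) ∈ Ideal.span {(24 : ℤ)} := by
  rw [Ideal.mem_span_singleton]
  have h1 := coeff_qDeriv_sub_mul_pow hUV hD (m + 1) 1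
  rw [Derivation.map_one_eq_zero, zero_sub, mul_one, neg_mul, map_neg, neg_eq_zero, mul_assoc,
    ← map_natCast (C (R := ℤ)), coeff_C_mul] at h1
  have h2 : coeff (m + 1) (c₂ * V ^ (m + 1)) = 0 :=
    (mul_eq_zero.mp h1).resolve_left (by positivity)
  obtain ⟨w, hw⟩ : (24 : ℤ⟦X⟧) ∣ c₄ ^ (3 * (m + 1)) - c₂ := by
    have h4 : (24 : ℤ⟦X⟧) ∣ c₄ - 1 :=
      ⟨10 * PowerSeries.mk fun n => (σ 3 n : ℤ), by rw [c₄]; ring⟩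
    have h5 : (24 : ℤ⟦X⟧) ∣ 1 - c₂ := ⟨PowerSeries.mk fun n => (σ 1 n : ℤ), by rw [c₂]; ring⟩
    have h6 := (h4.trans (sub_one_dvd_pow_sub_one c₄ (3 * (m + 1)))).add h5
    simpa using h6
  have h3 : c₄ ^ (3 * (m + 1)) * V ^ (m + 1) =
      c₂ * V ^ (m + 1) + C (24 : ℤ) * (w * V ^ (m + 1)) := by
    rw [show (C (24 : ℤ) : ℤ⟦X⟧) = 24 from map_ofNat _ 24]
    linear_combination V ^ (m + 1) * hw
  rw [h3, map_add, h2, zero_add, coeff_C_mul]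
  exact dvd_mul_right _ _

end Congruence

/-! ### Euler's product and Δ as formal power series -/

section Product

open PowerSeries
open scoped PowerSeries.WithPiTopology

theorem c₂_constantCoeff : constantCoeff c₂ = 1 := by
  simp [c₂]

theorem c₄_constantCoeff : constantCoeff c₄ = 1 := by
  simp [c₄]

/-- Euler's product `∏ (1 - qⁿ)`. -/
def eulerProd : ℤ⟦X⟧ :=
  ∏' n : ℕ, (1 - X ^ (n + 1))

theorem Δ_eq_X_mul_eulerProd_pow : Δ = X * eulerProd ^ 24 := by
  rw [Δ, eulerProd, (WithPiTopology.multipliable_one_sub_X_pow ℤ).tprod_pow]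

theorem exists_Δ_eq_X_mul : ∃ U V : ℤ⟦X⟧, Δ = X * U ∧ U * V = 1 := by
  have hU : constantCoeff (∏' n : ℕ, (1 - X ^ (n + 1) : ℤ⟦X⟧)) = 1 := by
    rw [(WithPiTopology.multipliable_one_sub_X_pow ℤ).map_tprod (constantCoeff (R := ℤ))
      (WithPiTopology.continuous_constantCoeff ℤ)]
    simp
  refine ⟨_, invOfUnit _ 1, Δ_eq_X_mul_eulerProd_pow, mul_invOfUnit _ 1 ?_⟩
  simp [eulerProd, hU]

/-- The coefficients of the partial products of `eulerProd` are eventually those of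
`eulerProd`. -/
theorem eventually_coeff_prod_eq (m : ℕ) :
    ∀ᶠ N in Filter.atTop, coeff m (∏ n ∈ Finset.range N, (1 - X ^ (n + 1) : ℤ⟦X⟧)) =
      coeff m eulerProd := by
  have h := (WithPiTopology.multipliable_one_sub_X_pow ℤ).hasProd.tendsto_prod_nat
  have h2 := ((WithPiTopology.continuous_coeff ℤ m).tendsto _).comp h
  exact h2 ((mem_nhds_discrete (s := {coeff m eulerProd})).mpr rfl)

end Product

/-! ### Functions on the upper half plane given by `q`-expansions -/

section QExpansion

open PowerSeries Function Complex Derivative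
open UpperHalfPlane hiding I
open scoped Manifold MatrixGroups ModularForm Topology Real

/-- The function `f` on the upper half plane is the sum of the power series `p` in
`q = exp (2πiτ)`. -/
def HasQExpansion (f : ℍ → ℂ) (p : ℂ⟦X⟧) : Prop :=
  ∀ τ : ℍ, HasSum (fun n : ℕ => coeff n p • Periodic.qParam 1 τ ^ n) (f τ)

namespace HasQExpansion

variable {f g : ℍ → ℂ} {p r : ℂ⟦X⟧}

theorem sub (hf : HasQExpansion f p) (hg : HasQExpansion g r) :
    HasQExpansion (f - g) (p - r) := fun τ => by
  simpa [sub_mul] using (hf τ).sub (hg τ)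

theorem const_smul (hf : HasQExpansion f p) (a : ℂ) : HasQExpansion (a • f) (a • p) := fun τ => by
  simpa [mul_assoc] using (hf τ).mul_left a

theorem mul (hf : HasQExpansion f p) (hg : HasQExpansion g r) :
    HasQExpansion (f * g) (p * r) := fun τ => by
  have h1 := (hf τ).summable.norm
  have h2 := (hg τ).summable.norm
  have h3 := (summable_norm_sum_mul_antidiagonal_of_summable_norm h1 h2).of_norm.hasSum
  rw [← tsum_mul_tsum_eq_tsum_sum_antidiagonal_of_summable_norm h1 h2, (hf τ).tsum_eq,
    (hg τ).tsum_eq] at h3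
  refine h3.congr_fun fun n => ?_
  rw [coeff_mul, Finset.sum_smul]
  refine Finset.sum_congr rfl fun kl hkl => ?_
  rw [← Finset.HasAntidiagonal.mem_antidiagonal.mp hkl, pow_add]
  simp only [smul_eq_mul]
  ring

theorem comp_ofComplex_eq (hf : HasQExpansion f p) {z : ℂ} (hz : 0 < z.im) :
    (f ∘ ofComplex) z = ∑' n : ℕ, coeff n p • Periodic.qParam 1 z ^ n := by
  rw [Function.comp_apply, ofComplex_apply_of_im_pos hz]
  exact (hf ⟨z, hz⟩).tsum_eq.symm

/-- On the half plane Im z > ε, |q| is smaller than its value at iε, where the series converges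
absolutely. This allows termwise differentiation. -/
theorem exists_summable_bound (hf : HasQExpansion f p) {ε : ℝ} (hε : 0 < ε) :
    ∃ u : ℕ → ℝ, Summable u ∧ ∀ (n : ℕ) (z : ℂ), z ∈ {z : ℂ | ε < z.im} →
      ‖coeff n p • Periodic.qParam 1 z ^ n‖ ≤ u n := by
  refine ⟨_, (hf ⟨ε * I, by simpa using hε⟩).summable.norm, fun n z hz => ?_⟩
  simp only [norm_smul, norm_pow]
  gcongr
  simp only [Periodic.norm_qParam]
  refine Real.exp_le_exp.mpr ?_
  have h : ε * (2 * π) ≤ z.im * (2 * π) :=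
    mul_le_mul_of_nonneg_right (le_of_lt hz) (by positivity)
  have him : ((⟨ε * I, by simpa using hε⟩ : ℍ) : ℂ).im = ε := by simp
  rw [him]
  linarith

theorem isOpen_im_gt (ε : ℝ) : IsOpen {z : ℂ | ε < z.im} :=
  isOpen_lt continuous_const continuous_im

theorem mdifferentiable (hf : HasQExpansion f p) : MDiff f := by
  rw [UpperHalfPlane.mdifferentiable_iff]
  intro z hz
  have hz' : (0 : ℝ) < z.im / 2 := half_pos hz
  obtain ⟨u, hu, hle⟩ := hf.exists_summable_bound hz'
  have h := differentiableOn_tsum_of_summable_norm hu (fun n => by fun_prop)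
    (isOpen_im_gt _) hle
  have hmem : {w : ℂ | z.im / 2 < w.im} ∈ 𝓝 z := (isOpen_im_gt _).mem_nhds (by simpa using hz)
  refine ((h.differentiableAt hmem).congr_of_eventuallyEq ?_).differentiableWithinAt
  filter_upwards [hmem] with w hw
  exact hf.comp_ofComplex_eq (hz'.trans hw)

theorem deriv (hf : HasQExpansion f p) :
    HasQExpansion (normalizedDerivOfComplex f) (qDeriv ℂ p) := fun τ => by
  have hz' : (0 : ℝ) < (τ : ℂ).im / 2 := half_pos τ.2
  obtain ⟨u, hu, hle⟩ := hf.exists_summable_bound hz'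
  have hmem : (τ : ℂ) ∈ {w : ℂ | (τ : ℂ).im / 2 < w.im} := half_lt_self τ.2
  have h := hasSum_deriv_of_summable_norm hu (fun n => by fun_prop) (isOpen_im_gt _) hle hmem
  have heq : _root_.deriv (f ∘ ofComplex) τ =
      _root_.deriv (fun z => ∑' n : ℕ, coeff n p • Periodic.qParam 1 z ^ n) τ := by
    refine Filter.EventuallyEq.deriv_eq ?_
    filter_upwards [(isOpen_im_gt _).mem_nhds hmem] with w hw
    exact hf.comp_ofComplex_eq (hz'.trans hw)
  rw [← heq] at h
  refine (h.mul_left (2 * π * I)⁻¹).congr_fun fun n => ?_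
  have hq : HasDerivAt (Periodic.qParam 1) (Periodic.qParam 1 τ * (2 * π * I)) (τ : ℂ) := by
    have := ((hasDerivAt_id (τ : ℂ)).const_mul (2 * π * I)).cexp
    have hfun : Periodic.qParam 1 = fun z => cexp (2 * π * I * z) := by
      ext z
      simp [Periodic.qParam]
    rw [hfun]
    simpa using this
  rw [((hq.fun_pow n).fun_const_smul (coeff n p)).deriv, coeff_qDeriv]
  cases n with
  | zero => simp
  | succ n =>
    simp only [smul_eq_mul, Nat.add_sub_cancel, pow_succ]
    field_simp

theorem isBoundedAtImInfty (hf : HasQExpansion f p) : IsBoundedAtImInfty f :=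
  isBoundedAtImInfty_of_hasSum_qExpansion one_pos hf

theorem slash_T (hf : HasQExpansion f p) (k : ℤ) : f ∣[k] ModularGroup.T = f := by
  ext τ
  rw [ModularForm.SL_slash_apply, modular_T_smul,
    show denom ModularGroup.T τ = 1 by simp [ModularGroup.denom_apply, ModularGroup.coe_T]]
  simp only [one_zpow, mul_one]
  refine (hf _).unique ((hf τ).congr_fun fun n => ?_)
  congr 2
  simp [Periodic.qParam, mul_add, Complex.exp_add]

/-- A function with a `q`-expansion that transforms correctly under `S` is a modular form of
level one. -/
theorem exists_modularForm (hf : HasQExpansion f p) {k : ℤ} (hS : f ∣[k] ModularGroup.S = f) :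
    ∃ F : ModularForm 𝒮ℒ k, ⇑F = f := by
  have hSL := SlashInvariantForm.slash_action_generators_SL2Z hS (hf.slash_T k)
  exact ⟨{  toFun := f
            slash_action_eq' := fun _ ⟨γ, hγ⟩ => hγ ▸ hSL γ
            holo' := hf.mdifferentiable
            bdd_at_cusps' := fun {c} hc => by
              rw [Subgroup.IsArithmetic.isCusp_iff_isCusp_SL2Z] at hc
              rw [OnePoint.isBoundedAt_iff_forall_SL2Z hc]
              intro γ _
              rw [hSL γ]
              exact hf.isBoundedAtImInfty }, rfl⟩

theorem qExpansion_eq {M : Type*} [FunLike M ℍ ℂ] {k : ℤ} [ModularFormClass M 𝒮ℒ k] {F : M}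
    (hF : HasQExpansion F p) :
    qExpansion 1 F = p := by
  ext n
  exact (ModularFormClass.qExpansion_coeff_unique (k := k) one_pos one_mem_strictPeriods_SL hF n).symm

end HasQExpansion

theorem hasQExpansion_modularForm {k : ℤ} (F : ModularForm 𝒮ℒ k) :
    HasQExpansion F (qExpansion 1 F) := fun τ =>
  by
  have : Fact (IsCusp OnePoint.infty 𝒮ℒ) :=
    ⟨Subgroup.isCusp_of_mem_strictPeriods one_pos one_mem_strictPeriods_SL⟩
  exact ModularForm.hasSum_qExpansion F one_pos one_mem_strictPeriods_SL τ

theorem hasQExpansion_E2 : HasQExpansion EisensteinSeries.E2 (PowerSeries.map (Int.castRingHom ℂ) c₂) :=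
    fun τ => by
  refine (EisensteinSeries.hasSum_qExpansion_E2 (z := τ)).congr_fun fun n => ?_
  have h24 : coeff n c₂ = if n = 0 then 1 else -24 * (σ 1 n : ℤ) := by
    rw [c₂, map_sub, coeff_one, ← map_ofNat (C (R := ℤ)) 24, coeff_C_mul, coeff_mk]
    split_ifs with h
    · simp [h]
    · ring
  rw [coeff_map, h24]
  simp only [Periodic.qParam, ofReal_one, div_one]
  split_ifs <;> simp

theorem qExpansion_E₄ : qExpansion 1 ModularForm.E₄ = PowerSeries.map (Int.castRingHom ℂ) c₄ := by
  ext n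
  rw [EisensteinSeries.E_qExpansion_coeff _ ⟨2, rfl⟩,
    show bernoulli 4 = -1 / 30 by decide +kernel, coeff_map, c₄, map_add, coeff_one,
    ← map_ofNat (C (R := ℤ)) 240, coeff_C_mul, coeff_mk]
  split_ifs with h
  · simp [h]
  · norm_num

/-- The derivative formula `Δ' = 2πi E₂ Δ`. -/
theorem normalizedDeriv_discriminant :
    normalizedDerivOfComplex ModularForm.discriminant =
      EisensteinSeries.E2 * ModularForm.discriminant := by
  ext τ
  have hη := ModularForm.differentiableAt_eta_of_mem_upperHalfPlaneSet τ.2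
  have heq : _root_.deriv (ModularForm.discriminant ∘ ofComplex) τ =
      _root_.deriv (fun z => ModularForm.eta z ^ 24) τ := by
    refine Filter.EventuallyEq.deriv_eq ?_
    filter_upwards [isOpen_upperHalfPlaneSet.mem_nhds τ.2] with w hw
    simp [ModularForm.discriminant, ofComplex_apply_of_im_pos hw]
  have hlog := ModularForm.logDeriv_eta_eq_E2 τ
  rw [logDeriv_apply, div_eq_iff (ModularForm.eta_ne_zero τ.2)] at hlog
  rw [normalizedDerivOfComplex, heq, (hη.hasDerivAt.fun_pow 24).deriv, hlog, Pi.mul_apply,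
    ModularForm.discriminant]
  push_cast
  field_simp
  ring_nf

end QExpansion

/-! ### The analytic discriminant has the formal Δ as its expansion -/

section EulerProduct

open PowerSeries Function Complex Derivative
open UpperHalfPlane hiding I
open scoped Manifold MatrixGroups ModularForm Topology Real

theorem tendstoLocallyUniformlyOn_iteratedDeriv {F : ℕ → ℂ → ℂ} {f : ℂ → ℂ} {U : Set ℂ}
    (hU : IsOpen U) (hF : ∀ n, ContDiff ℂ ⊤ (F n))
    (h : TendstoLocallyUniformlyOn F f Filter.atTop U) (m : ℕ) :
    TendstoLocallyUniformlyOn (fun n => iteratedDeriv m (F n)) (iteratedDeriv m f)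
      Filter.atTop U := by
  induction m with
  | zero => simpa using h
  | succ m ih =>
    simp only [iteratedDeriv_succ]
    exact ih.deriv (.of_forall fun n => ((hF n).differentiable_iteratedDeriv m
      (by exact_mod_cast WithTop.coe_lt_top _)).differentiableOn) hU

theorem iteratedDeriv_polynomial_eval (P : Polynomial ℂ) (m : ℕ) :
    iteratedDeriv m (fun z => P.eval z) = fun z => (Polynomial.derivative^[m] P).eval z := by
  induction m with
  | zero => simp
  | succ m ih =>
    rw [iteratedDeriv_succ, ih, Function.iterate_succ_apply']
    ext z
    exact Polynomial.deriv _

theorem iteratedDeriv_polynomial_eval_zero (P : Polynomial ℂ) (m : ℕ) :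
    iteratedDeriv m (fun z => P.eval z) 0 = m.factorial * P.coeff m := by
  rw [iteratedDeriv_polynomial_eval]
  simp only [← Polynomial.coeff_zero_eq_eval_zero, Polynomial.coeff_iterate_derivative, zero_add,
    Nat.descFactorial_self, nsmul_eq_mul]

/-- Locally uniform limits commute with derivatives, so the Taylor coefficients of the product are
limits of those of the partial products. The latter are eventually constant, equal to the formal
coefficients. -/
theorem iteratedDeriv_tprod_one_sub_pow (m : ℕ) :
    iteratedDeriv m (fun q : ℂ => ∏' n : ℕ, (1 - q ^ (n + 1))) 0 =
      m.factorial * (coeff m eulerProd : ℤ) := by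
  have h := ModularForm.multipliableLocallyUniformlyOn_one_sub_pow.hasProdLocallyUniformlyOn
  have h1 := tendstoLocallyUniformlyOn_iteratedDeriv Metric.isOpen_ball
    (fun n => contDiff_prod fun _ _ => by fun_prop) h.tendstoLocallyUniformlyOn_finsetRange m
  have h2 := h1.tendsto_at (Metric.mem_ball_self one_pos : (0 : ℂ) ∈ _)
  refine tendsto_nhds_unique h2 (tendsto_const_nhds.congr' ?_)
  filter_upwards [eventually_coeff_prod_eq m] with N hN
  have hP : (fun z : ℂ => ∏ n ∈ Finset.range N, (1 - z ^ (n + 1))) =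
      fun z => ((∏ n ∈ Finset.range N, (1 - Polynomial.X ^ (n + 1) : Polynomial ℤ)).map
        (Int.castRingHom ℂ)).eval z := by
    ext z
    simp [Polynomial.map_prod, Polynomial.eval_prod]
  have hcoe : ((∏ n ∈ Finset.range N, (1 - Polynomial.X ^ (n + 1) : Polynomial ℤ) :
      Polynomial ℤ) : ℤ⟦X⟧) = ∏ n ∈ Finset.range N, (1 - X ^ (n + 1) : ℤ⟦X⟧) := by
    rw [← Polynomial.coeToPowerSeries.ringHom_apply, map_prod]
    simp
  rw [hP, iteratedDeriv_polynomial_eval_zero, Polynomial.coeff_map, ← Polynomial.coeff_coe, hcoe,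
    hN]
  rfl

theorem hasQExpansion_tprod :
    HasQExpansion (fun τ : ℍ => ∏' n : ℕ, (1 - Periodic.qParam 1 τ ^ (n + 1)))
      (PowerSeries.map (Int.castRingHom ℂ) eulerProd) := fun τ => by
  have h := hasSum_taylorSeries_on_ball ModularForm.differentiableOn_tprod_one_sub_pow
    (z := Periodic.qParam 1 τ) (by simpa using Periodic.norm_qParam_lt_one one_pos τ.im_pos)
  refine h.congr_fun fun n => ?_
  rw [iteratedDeriv_tprod_one_sub_pow, coeff_map, sub_zero]
  have : (n.factorial : ℂ) ≠ 0 := by exact_mod_cast n.factorial_ne_zero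
  simp only [smul_eq_mul, eq_intCast]
  field_simp

theorem hasQExpansion_one : HasQExpansion 1 1 := fun τ => by
  convert! hasSum_ite_eq (0 : ℕ) (1 : ℂ) using 2 with n
  rw [coeff_one]
  split_ifs with h <;> simp [h]

theorem HasQExpansion.pow {f : ℍ → ℂ} {p : ℂ⟦X⟧} (hf : HasQExpansion f p) (n : ℕ) :
    HasQExpansion (f ^ n) (p ^ n) := by
  induction n with
  | zero => simpa using hasQExpansion_one
  | succ n ih => simpa [pow_succ] using ih.mul hf

theorem hasQExpansion_qParam : HasQExpansion (fun τ : ℍ => Periodic.qParam 1 τ) X := fun τ => by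
  convert! hasSum_ite_eq (1 : ℕ) (Periodic.qParam 1 τ) using 2 with n
  rw [coeff_X]
  split_ifs with h <;> simp [h]

theorem hasQExpansion_discriminant :
    HasQExpansion ModularForm.discriminant (PowerSeries.map (Int.castRingHom ℂ) Δ) := by
  have h := hasQExpansion_qParam.mul (hasQExpansion_tprod.pow 24)
  rw [Δ_eq_X_mul_eulerProd_pow, map_mul, map_pow, map_X]
  convert! h using 1
  ext τ
  rw [ModularForm.discriminant_eq_q_prod, Pi.mul_apply, Pi.pow_apply,
    (ModularForm.multipliable_one_sub_pow
      (Periodic.norm_qParam_lt_one one_pos τ.im_pos)).tprod_pow]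

end EulerProduct

/-! ### Level-one modular forms: division by Δ and constant terms -/

section LevelOne

open PowerSeries Function Complex Derivative
open UpperHalfPlane hiding I
open scoped Manifold MatrixGroups ModularForm Topology Real

theorem HasQExpansion.unique {f : ℍ → ℂ} {p r : ℂ⟦X⟧} (hp : HasQExpansion f p)
    (hr : HasQExpansion f r) : p = r := by
  have h := hp.sub hr
  rw [sub_self] at h
  -- The difference represents the zero function, which is a modular form, so uniqueness of
  -- expansions of modular forms applies although `f` need not be modular.
  have h0 : HasQExpansion (0 : ModularForm 𝒮ℒ 0) (p - r) := h
  have h1 : HasQExpansion (0 : ModularForm 𝒮ℒ 0) 0 := fun τ => by simp [hasSum_zero]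
  exact sub_eq_zero.mp (h0.qExpansion_eq.symm.trans h1.qExpansion_eq)

theorem map_intCast_injective :
    Function.Injective (PowerSeries.map (Int.castRingHom ℂ)) :=
  PowerSeries.map_injective _ (RingHom.injective_int _)

/-- The logarithmic derivative of η gives the identity for functions; uniqueness of expansions
transfers it to formal series over `ℤ`. -/
theorem qDeriv_Δ : qDeriv ℤ Δ = c₂ * Δ := by
  apply map_intCast_injective
  rw [← qDeriv_map, map_mul]
  refine hasQExpansion_discriminant.deriv.unique ?_
  rw [normalizedDeriv_discriminant]
  exact hasQExpansion_E2.mul hasQExpansion_discriminant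

theorem hasQExpansion_E₄_pow (n : ℕ) :
    HasQExpansion (ModularForm.E₄.pow n) (PowerSeries.map (Int.castRingHom ℂ) (c₄ ^ n)) := by
  rw [ModularForm.coe_pow, map_pow, ← qExpansion_E₄]
  exact (hasQExpansion_modularForm _).pow n

theorem HasQExpansion.serreDerivative {f : ℍ → ℂ} {p : ℂ⟦X⟧} (hf : HasQExpansion f p) (k : ℕ) :
    HasQExpansion (serreDerivative (12 * k) f)
      (qDeriv ℂ p - (k : ℂ⟦X⟧) * PowerSeries.map (Int.castRingHom ℂ) c₂ * p) := by
  have h := hf.deriv.sub ((hasQExpansion_E2.mul hf).const_smul (k : ℂ))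
  convert! h using 1
  · ext τ
    simp only [serreDerivative_apply, Pi.sub_apply, Pi.smul_apply, Pi.mul_apply, smul_eq_mul]
    ring
  · rw [PowerSeries.smul_eq_C_mul, map_natCast, mul_assoc]

theorem qExpansion_discriminant :
    qExpansion 1 ModularForm.discriminant = PowerSeries.map (Int.castRingHom ℂ) Δ :=
  HasQExpansion.qExpansion_eq (F := CuspForm.discriminant) hasQExpansion_discriminant

theorem Δ_ne_zero : Δ ≠ 0 := fun h => by
  have h1 := qExpansion_discriminant
  rw [h, map_zero] at h1
  simpa [h1] using ModularForm.discriminant_qExpansion_coeff_one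

theorem map_Δ_ne_zero : PowerSeries.map (Int.castRingHom ℂ) Δ ≠ 0 :=
  (map_ne_zero_iff _ map_intCast_injective).mpr Δ_ne_zero

/-- The Serre derivative of `E₄ ^ (3 k)` as a modular form of weight `12 k + 2`. -/
theorem exists_serreDerivative_E₄_pow (k : ℕ) :
    ∃ H : ModularForm 𝒮ℒ (12 * k + 2), qExpansion 1 H =
      qDeriv ℂ (PowerSeries.map (Int.castRingHom ℂ) (c₄ ^ (3 * k))) -
        (k : ℂ⟦X⟧) * PowerSeries.map (Int.castRingHom ℂ) c₂ *
          PowerSeries.map (Int.castRingHom ℂ) (c₄ ^ (3 * k)) := by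
  have h := (hasQExpansion_E₄_pow (3 * k)).serreDerivative k
  have hinv : (⇑(ModularForm.E₄.pow (3 * k))) ∣[(12 * k : ℤ)] ModularGroup.S =
      ⇑(ModularForm.E₄.pow (3 * k)) := by
    exact SlashInvariantFormClass.slash_action_eq (Γ := 𝒮ℒ)
      (ModularForm.mcast (b := 12 * k) (by push_cast; ring) (ModularForm.E₄.pow (3 * k)))
      _ ⟨ModularGroup.S, rfl⟩
  have hS := serreDerivative_slash_invariant (k := 12 * k)
    (hasQExpansion_E₄_pow (3 * k)).mdifferentiable hinv
  push_cast at hS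
  obtain ⟨H, hH⟩ := h.exists_modularForm hS
  rw [← hH] at h
  exact ⟨H, h.qExpansion_eq⟩

/-- If `G` is a modular form of weight `12 k + 2` and level one then the constant term of
`G / Δ ^ k` vanishes. -/
theorem coeff_qExpansion_mul_pow_eq_zero {U V : ℤ⟦X⟧} (hΔ : Δ = X * U) (hUV : U * V = 1) (k : ℕ)
    {w : ℤ} (hw : w = 12 * k + 2) (G : ModularForm 𝒮ℒ w) :
    coeff k (qExpansion 1 G * PowerSeries.map (Int.castRingHom ℂ) V ^ k) = 0 := by
  have hUV' : PowerSeries.map (Int.castRingHom ℂ) U * PowerSeries.map (Int.castRingHom ℂ) V = 1 := by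
    rw [← map_mul, hUV, map_one]
  have hΔ' : PowerSeries.map (Int.castRingHom ℂ) Δ = X * PowerSeries.map (Int.castRingHom ℂ) U := by
    rw [hΔ, map_mul, map_X]
  induction k generalizing w with
  | zero =>
    obtain rfl : w = 2 := by simpa using hw
    rw [rank_zero_iff_forall_zero.mp ModularForm.levelOne_weight_two_rank_zero G]
    simp [qExpansion_zero]
  | succ k ih =>
    subst hw
    obtain ⟨H, hH⟩ := exists_serreDerivative_E₄_pow (k + 1)
    have hH0 : coeff 0 (qExpansion 1 H) = -(k + 1 : ℂ) := by
      rw [hH, map_sub, coeff_qDeriv]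
      simp [constantCoeff_map, c₄_constantCoeff, c₂_constantCoeff]
    -- Chosen so that G + aH is a cusp form. It can then be divided by Δ, while H contributes
    -- nothing to the constant term sought because H/Δ^(k+1) is a `q`-derivative.
    set a : ℂ := coeff 0 (qExpansion 1 G) / (k + 1)
    have hk : (k + 1 : ℂ) ≠ 0 := by exact_mod_cast k.succ_ne_zero
    let F := G + a • H
    have hF : qExpansion 1 F = qExpansion 1 G + a • qExpansion 1 H := by
      rw [← ModularForm.qExpansion_smul one_pos one_mem_strictPeriods_SL]
      exact ModularForm.qExpansion_add one_pos one_mem_strictPeriods_SL G (a • H)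
    have hF0 : coeff 0 (qExpansion 1 F) = 0 := by
      rw [hF, map_add, coeff_smul, hH0, smul_eq_mul]
      simp only [a]
      field_simp
      ring
    have h1 := ModularForm.qExpansion_eq_qExpansion_discriminant_mul F hF0
    have h2 := ih (by push_cast; ring) (CuspForm.discriminantEquiv (ModularForm.toCuspForm F hF0))
    have h3 := coeff_mul_pow_succ hUV' k
      (qExpansion 1 (CuspForm.discriminantEquiv (ModularForm.toCuspForm F hF0)))
    rw [← hΔ', ← qExpansion_discriminant, ← h1, h2, hF, add_mul, map_add, smul_mul_assoc,
      coeff_smul, hH, coeff_qDeriv_sub_mul_pow hUV', smul_zero, add_zero] at h3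
    · exact h3
    · rw [← hΔ', qDeriv_map, qDeriv_Δ, map_mul]

/-- A modular form of weight `12 k` with integral `q`-expansion is an integral combination of the
forms `c₄ ^ (3 (k - i)) Δ ^ i`. -/
theorem exists_homogSum_eq {U V : ℤ⟦X⟧} (hΔ : Δ = X * U) (hUV : U * V = 1) (k : ℕ)
    {w : ℤ} (hw : w = 12 * k) (F : ModularForm 𝒮ℒ w) {f : ℤ⟦X⟧}
    (hf : qExpansion 1 F = PowerSeries.map (Int.castRingHom ℂ) f) :
    ∃ x, f = homogSum c₄ Δ k x := by
  induction k generalizing w f with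
  | zero =>
    obtain rfl : w = 0 := by simpa using hw
    obtain ⟨c, hc⟩ := ModularFormClass.levelOne_weight_zero_const F
    have h1 : HasQExpansion F (c • 1) := by
      have h2 := hasQExpansion_one.const_smul c
      convert! h2 using 1
      ext τ
      simp [hc]
    have h3 := hf.symm.trans h1.qExpansion_eq
    refine ⟨fun _ => constantCoeff f, ?_⟩
    have h5 : homogSum c₄ Δ 0 (fun _ => constantCoeff f) = C (constantCoeff f) := by
      simp [homogSum]
    rw [h5]
    ext n
    have h4 := congrArg (coeff n) h3
    cases n with
    | zero => simp
    | succ n =>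
      rw [coeff_C, if_neg n.succ_ne_zero]
      simpa [coeff_one] using h4
  | succ k ih =>
    subst hw
    set a : ℤ := constantCoeff f
    let H : ModularForm 𝒮ℒ (12 * ((k + 1 : ℕ) : ℤ)) :=
      ModularForm.mcast (by push_cast; ring) (ModularForm.E₄.pow (3 * (k + 1)))
    have hH : qExpansion 1 H = PowerSeries.map (Int.castRingHom ℂ) (c₄ ^ (3 * (k + 1))) :=
      (hasQExpansion_E₄_pow (3 * (k + 1))).qExpansion_eq
    let G := F - (a : ℂ) • H
    have hG : qExpansion 1 G =
        PowerSeries.map (Int.castRingHom ℂ) (f - C a * c₄ ^ (3 * (k + 1))) := by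
      rw [map_sub, map_mul, ← hf, ← hH, map_C, eq_intCast, ← smul_eq_C_mul,
        ← ModularForm.qExpansion_smul one_pos one_mem_strictPeriods_SL]
      exact ModularForm.qExpansion_sub one_pos one_mem_strictPeriods_SL F ((a : ℂ) • H)
    have h0 : constantCoeff (f - C a * c₄ ^ (3 * (k + 1))) = 0 := by
      simp [c₄_constantCoeff, a]
    have hG0 : coeff 0 (qExpansion 1 G) = 0 := by
      rw [hG, coeff_map, coeff_zero_eq_constantCoeff_apply, h0, map_zero]
    -- Divisibility by `X` is divisibility by Δ over `ℤ`, as `U` is a unit. The quotient form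
    -- therefore keeps an integral expansion.
    obtain ⟨h, hh⟩ := X_dvd_iff.mpr h0
    have hΔh : f - C a * c₄ ^ (3 * (k + 1)) = Δ * (V * h) := by
      rw [hh, hΔ]
      linear_combination -X * h * hUV
    have h1 := ModularForm.qExpansion_eq_qExpansion_discriminant_mul G hG0
    rw [hG, hΔh, map_mul, qExpansion_discriminant] at h1
    obtain ⟨x, hx⟩ := ih (by push_cast; ring)
      (CuspForm.discriminantEquiv (ModularForm.toCuspForm G hG0))
      (mul_left_cancel₀ map_Δ_ne_zero h1).symm
    refine ⟨Fin.cons a x, ?_⟩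
    rw [homogSum_succ]
    simp only [Fin.cons_zero, Fin.cons_succ]
    rw [← hx, ← hΔh]
    ring

end LevelOne

/-! ### Poisson summation on ℝ^ι -/

section Poisson

open MeasureTheory Complex Topology
open scoped Real

variable {ι : Type*}

/-- The half-open unit cube of `ℝ ^ ι` with corner `n`. -/
def unitCube (n : ι → ℤ) : Set (ι → ℝ) :=
  {x | ∀ i, x i ∈ Set.Ioc (n i : ℝ) (n i + 1)}

theorem measurableSet_unitCube [Countable ι] (n : ι → ℤ) : MeasurableSet (unitCube n) :=
  MeasurableSet.univ_pi' fun _ => measurableSet_Ioc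

theorem iUnion_unitCube : ⋃ n : ι → ℤ, unitCube n = Set.univ := by
  -- The cubes are open on the left, so the corner is the ceiling minus one rather than the floor.
  refine Set.eq_univ_of_forall fun x => Set.mem_iUnion.mpr ⟨fun i => ⌈x i⌉ - 1, fun i => ?_⟩
  have h1 := Int.ceil_lt_add_one (x i)
  have h2 := Int.le_ceil (x i)
  constructor <;> push_cast <;> linarith

theorem pairwise_disjoint_unitCube :
    Pairwise (Function.onFun Disjoint (unitCube (ι := ι))) := by
  intro n m hnm
  refine Set.disjoint_left.mpr fun x hx hy => hnm (funext fun i => ?_)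
  have h1 : ((n i : ℤ) : ℝ) < m i + 1 := (hx i).1.trans_le (hy i).2
  have h2 : ((m i : ℤ) : ℝ) < n i + 1 := (hy i).1.trans_le (hx i).2
  norm_cast at h1 h2
  lia

variable [Fintype ι]

theorem setIntegral_unitCube {E : Type*} [NormedAddCommGroup E] [NormedSpace ℝ E]
    (g : (ι → ℝ) → E) (n : ι → ℤ) :
    ∫ x in unitCube n, g x = ∫ x in unitCube 0, g (x + fun i => (n i : ℝ)) := by
  rw [← (measurePreserving_add_right volume (fun i => (n i : ℝ))).setIntegral_preimage_emb
    (measurableEmbedding_addRight _)]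
  congr 2
  ext x
  simp only [unitCube, Set.mem_preimage, Set.mem_ofPred_eq, Pi.add_apply, Set.mem_Ioc, Pi.zero_apply,
    Int.cast_zero, zero_add]
  refine forall_congr' fun i => and_congr ?_ ?_ <;> constructor <;> intro h <;> linarith

theorem hasSum_setIntegral_unitCube {E : Type*} [NormedAddCommGroup E] [NormedSpace ℝ E]
    {g : (ι → ℝ) → E} (hg : Integrable g) :
    HasSum (fun n : ι → ℤ => ∫ x in unitCube 0, g (x + fun i => (n i : ℝ))) (∫ x, g x) := by
  have h := hasSum_integral_iUnion (f := g) (μ := volume) measurableSet_unitCube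
    pairwise_disjoint_unitCube hg.integrableOn
  rw [iUnion_unitCube, setIntegral_univ] at h
  exact h.congr_fun fun n => (setIntegral_unitCube g n).symm

theorem integral_unitCube_tsum {g : (ι → ℝ) → ℂ} (hg : Integrable g) :
    ∫ x in unitCube 0, ∑' n : ι → ℤ, g (x + fun i => (n i : ℝ)) = ∫ x, g x := by
  rw [← integral_tsum_of_summable_integral_norm
    (fun n => (hg.comp_add_right _).integrableOn)
    (hasSum_setIntegral_unitCube hg.norm).summable]
  exact (hasSum_setIntegral_unitCube hg).tsum_eq

theorem mFourier_coe (m : ι → ℤ) (x : ι → ℝ) :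
    UnitAddTorus.mFourier m (fun i => (x i : UnitAddCircle)) =
      cexp (2 * π * I * ∑ i, (m i : ℂ) * x i) := by
  simp only [UnitAddTorus.mFourier, ContinuousMap.coe_mk, fourier_coe_apply, Finset.mul_sum,
    Complex.exp_sum]
  refine Finset.prod_congr rfl fun i _ => ?_
  congr 1
  push_cast
  ring

/-- The Poisson summation formula on `ℝ ^ ι`. -/
theorem hasSum_fourier_tsum {f : (ι → ℝ) → ℂ} (hcont : Continuous f) (hint : Integrable f)
    (hbound : ∀ R : ℝ, ∃ u : (ι → ℤ) → ℝ, Summable u ∧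
      ∀ (n : ι → ℤ) (x : ι → ℝ), ‖x‖ ≤ R → ‖f (x + fun i => (n i : ℝ))‖ ≤ u n)
    {c : (ι → ℤ) → ℂ}
    (hc : ∀ m, ∫ y, cexp (-(2 * π * I * ∑ i, (m i : ℂ) * y i)) * f y = c m)
    (hsum : Summable c) (x : ι → ℝ) :
    HasSum (fun m : ι → ℤ => c m * cexp (2 * π * I * ∑ i, (m i : ℂ) * x i))
      (∑' n : ι → ℤ, f (x + fun i => (n i : ℝ))) := by
  set S : (ι → ℝ) → ℂ := fun x => ∑' n : ι → ℤ, f (x + fun i => (n i : ℝ)) with hS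
  have hScont : Continuous S := by
    rw [continuous_iff_continuousAt]
    intro x
    obtain ⟨u, hu, hle⟩ := hbound (‖x‖ + 1)
    have h := continuousOn_tsum (s := {y : ι → ℝ | ‖y‖ ≤ ‖x‖ + 1})
      (f := fun (n : ι → ℤ) y => f (y + fun i => (n i : ℝ)))
      (fun n => by fun_prop) hu (fun n y hy => hle n y hy)
    refine h.continuousAt ?_
    filter_upwards [continuous_norm.continuousAt.eventually_lt_const (lt_add_one ‖x‖)] with y hy
    exact hy.le
  have hSper : ∀ (x : ι → ℝ) (k : ι → ℤ), S (x + fun i => (k i : ℝ)) = S x := by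
    intro x k
    simp only [hS]
    rw [← (Equiv.addLeft k).tsum_eq (fun n : ι → ℤ => f (x + fun i => (n i : ℝ)))]
    refine tsum_congr fun n => congrArg f ?_
    ext i
    simp [add_assoc]
  -- The periodisation `S` descends along `q` to a continuous function on the torus, whose Fourier
  -- coefficients unfold to the integrals `c m` over the whole space.
  let q : C(ι → ℝ, UnitAddTorus ι) := ⟨fun x i => (x i : UnitAddCircle),
    continuous_pi fun i => (AddCircle.continuous_mk' 1).comp (continuous_apply i)⟩
  have hq : IsQuotientMap q :=
    (IsOpenQuotientMap.piMap fun _ : ι => QuotientAddGroup.isOpenQuotientMap_mk).isQuotientMap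
  have hlift : Function.FactorsThrough S q := by
    intro a b hab
    have h1 : ∀ i, ∃ k : ℤ, a i = b i + k := fun i => by
      have h2 : ((a i - b i : ℝ) : UnitAddCircle) = 0 := by
        rw [AddCircle.coe_sub, sub_eq_zero]
        exact congrFun hab i
      obtain ⟨k, hk⟩ := AddCircle.coe_eq_zero_iff _ |>.mp h2
      exact ⟨k, by rw [zsmul_one] at hk; linarith⟩
    choose k hk using h1
    rw [← hSper b k]
    congr 1
    exact funext hk
  let F : C(UnitAddTorus ι, ℂ) := hq.lift ⟨S, hScont⟩ hlift
  have hF : ∀ x, F (q x) = S x := fun x =>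
    DFunLike.congr_fun (hq.lift_comp ⟨S, hScont⟩ hlift) x
  have hcoeff : UnitAddTorus.mFourierCoeff F = c := by
    ext m
    have he : ∀ y : ι → ℝ, UnitAddTorus.mFourier (-m) (q y) =
        cexp (-(2 * π * I * ∑ i, (m i : ℂ) * y i)) := fun y => by
      refine (mFourier_coe (-m) y).trans ?_
      simp
    have hper : ∀ (y : ι → ℝ) (n : ι → ℤ), q (y + fun i => (n i : ℝ)) = q y := fun y n => by
      ext i
      simp [q]
    have hgint : Integrable fun y : ι → ℝ =>
        cexp (-(2 * π * I * ∑ i, (m i : ℂ) * y i)) * f y := by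
      refine hint.mono (by fun_prop) (.of_forall fun y => ?_)
      rw [norm_mul, ← he]
      refine mul_le_of_le_one_left (norm_nonneg _) ?_
      exact (ContinuousMap.norm_coe_le_norm _ _).trans UnitAddTorus.mFourier_norm.le
    rw [UnitAddTorus.mFourierCoeff_eq_integral _ _ 0, ← hc, ← integral_unitCube_tsum hgint]
    have hset : {x : ι → ℝ | ∀ i, x i ∈ Set.Ioc ((0 : ι → ℝ) i) ((0 : ι → ℝ) i + 1)} =
        unitCube 0 := by
      simp [unitCube]
    rw [hset]
    congr 1
    ext y
    change UnitAddTorus.mFourier (-m) (q y) • F (q y) = _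
    rw [hF, hS, smul_eq_mul, ← tsum_mul_left]
    refine tsum_congr fun n => ?_
    rw [← he, hper]
  have hfin := UnitAddTorus.hasSum_mFourier_series_apply_of_summable (f := F)
    (by rwa [hcoeff]) (q x)
  rw [hF, hcoeff] at hfin
  refine hfin.congr_fun fun m => ?_
  rw [smul_eq_mul]
  congr 1
  exact (mFourier_coe m x).symm

end Poisson

/-! ### Gaussians attached to a quadratic form -/

section Gaussian

open MeasureTheory Complex Topology Matrix
open scoped Real

variable {ι : Type*} [Fintype ι]

/-- A finite set of multi-indices lies in a box, over which the sum of products factors. -/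
theorem summable_prod_of_nonneg {α : Type*} {f : ι → α → ℝ} (h0 : ∀ i a, 0 ≤ f i a)
    (hf : ∀ i, Summable (f i)) : Summable fun x : ι → α => ∏ i, f i (x i) := by
  classical
  refine summable_of_sum_le (c := ∏ i, ∑' a, f i a)
    (fun x => Finset.prod_nonneg fun i _ => h0 i _) fun u => ?_
  calc ∑ x ∈ u, ∏ i, f i (x i)
      ≤ ∑ x ∈ Fintype.piFinset fun i => u.image fun x => x i, ∏ i, f i (x i) :=
        Finset.sum_le_sum_of_subset_of_nonneg
          (fun x hx => Fintype.mem_piFinset.mpr fun i => Finset.mem_image_of_mem _ hx)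
          fun x _ _ => Finset.prod_nonneg fun i _ => h0 i _
    _ = ∏ i, ∑ a ∈ u.image fun x => x i, f i a := (Finset.prod_univ_sum _ _).symm
    _ ≤ ∏ i, ∑' a, f i a := Finset.prod_le_prod
        (fun i _ => Finset.sum_nonneg fun a _ => h0 i a)
        fun i _ => (hf i).sum_le_tsum _ fun a _ => h0 i a

theorem summable_exp_neg_sq_add_abs {T : ℝ} (hT : 0 < T) (S : ℝ) :
    Summable fun n : ι → ℤ => Real.exp (∑ i, (-T * (n i : ℝ) ^ 2 + S * |(n i : ℝ)|)) := by
  simp_rw [Real.exp_sum]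
  refine summable_prod_of_nonneg (f := fun _ (n : ℤ) => Real.exp (-T * (n : ℝ) ^ 2 + S * |(n : ℝ)|))
    (fun _ _ => (Real.exp_pos _).le) fun _ => ?_
  -- The bound for Jacobi's theta terms is exp(-π(T'n² - 2S'|n|)); take T' = T/π and S' = S/(2π).
  have h := summable_pow_mul_jacobiTheta₂_term_bound (S / (2 * π)) (div_pos hT Real.pi_pos) 0
  refine h.congr fun n => ?_
  simp only [pow_zero, one_mul, Int.cast_abs]
  congr 1
  field_simp
  ring

variable [DecidableEq ι]

theorem exists_mul_sum_sq_le {M : Matrix ι ι ℝ} (hM : IsUnit M.det) :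
    ∃ a > 0, ∀ y : ι → ℝ, a * ∑ i, y i ^ 2 ≤ M *ᵥ y ⬝ᵥ M *ᵥ y := by
  set K : ℝ := ∑ i, ∑ j, M⁻¹ i j ^ 2
  have hK : 0 ≤ K := Finset.sum_nonneg fun i _ => Finset.sum_nonneg fun j _ => sq_nonneg _
  -- Cauchy–Schwarz for `M⁻¹` gives the constant K; adding 1 keeps it positive when ι is empty.
  refine ⟨(K + 1)⁻¹, by positivity, fun y => ?_⟩
  set z := M *ᵥ y with hz
  have hy : y = M⁻¹ *ᵥ z := by rw [hz, mulVec_mulVec, nonsing_inv_mul _ hM, one_mulVec]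
  have hzz : z ⬝ᵥ z = ∑ j, z j ^ 2 := by simp [dotProduct, sq]
  have hz0 : 0 ≤ z ⬝ᵥ z := hzz ▸ Finset.sum_nonneg fun j _ => sq_nonneg _
  have h : ∑ i, y i ^ 2 ≤ K * (z ⬝ᵥ z) := by
    rw [Finset.sum_mul]
    refine Finset.sum_le_sum fun i _ => ?_
    rw [hy, hzz]
    exact Finset.sum_mul_sq_le_sq_mul_sq _ _ _
  rw [inv_mul_le_iff₀ (by positivity)]
  nlinarith

theorem norm_cexp_pi_mul_I {τ : ℂ} (r : ℝ) : ‖cexp (π * I * τ * r)‖ = Real.exp (-(π * τ.im) * r) := by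
  rw [Complex.norm_exp]
  congr 1
  simp [Complex.mul_re, Complex.mul_im]

/-- Translates of a Gaussian are dominated, uniformly on balls, by a summable family. -/
theorem exists_summable_gaussian_bound {M : Matrix ι ι ℝ} (hM : IsUnit M.det) {τ : ℂ}
    (hτ : 0 < τ.im) (R : ℝ) :
    ∃ u : (ι → ℤ) → ℝ, Summable u ∧ ∀ (n : ι → ℤ) (x : ι → ℝ), ‖x‖ ≤ R →
      ‖cexp (π * I * τ * ((M *ᵥ (x + fun i => (n i : ℝ)) ⬝ᵥ M *ᵥ (x + fun i => (n i : ℝ)) : ℝ) : ℂ))‖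
        ≤ u n := by
  obtain ⟨a, ha, hle⟩ := exists_mul_sum_sq_le hM
  have hT : 0 < π * τ.im * a := by positivity
  refine ⟨_, summable_exp_neg_sq_add_abs hT (π * τ.im * a * (2 * R)), fun n x hx => ?_⟩
  rw [norm_cexp_pi_mul_I]
  refine Real.exp_le_exp.mpr ?_
  have h1 : ∑ i, ((n i : ℝ) ^ 2 - 2 * R * |(n i : ℝ)|) ≤ ∑ i, (x i + n i) ^ 2 := by
    refine Finset.sum_le_sum fun i _ => ?_
    have h2 : |x i| ≤ R := (norm_le_pi_norm x i).trans hx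
    have h3 : -(|x i| * |(n i : ℝ)|) ≤ x i * n i := by
      rw [← abs_mul]
      exact neg_abs_le _
    have h4 := mul_le_mul_of_nonneg_right h2 (abs_nonneg (n i : ℝ))
    nlinarith [sq_nonneg (x i)]
  have h5 := mul_le_mul_of_nonneg_left ((mul_le_mul_of_nonneg_left h1 ha.le).trans
    (hle (x + fun i => (n i : ℝ)))) (mul_pos Real.pi_pos hτ).le
  calc -(π * τ.im) * (M *ᵥ (x + fun i => (n i : ℝ)) ⬝ᵥ M *ᵥ (x + fun i => (n i : ℝ)))
      ≤ -(π * τ.im * (a * ∑ i, ((n i : ℝ) ^ 2 - 2 * R * |(n i : ℝ)|))) := by linarith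
    _ = _ := by
      rw [Finset.mul_sum, Finset.mul_sum, ← Finset.sum_neg_distrib]
      exact Finset.sum_congr rfl fun i _ => by ring

theorem measurePreserving_mulVec {M : Matrix ι ι ℝ} (hM : |M.det| = 1) :
    MeasurePreserving (fun y : ι → ℝ => M *ᵥ y) volume volume := by
  refine ⟨by fun_prop, ?_⟩
  have h := Real.map_matrix_volume_pi_eq_smul_volume_pi (M := M)
    (fun h => by rw [h] at hM; simp at hM)
  rw [abs_inv, hM, inv_one, ENNReal.ofReal_one, one_smul] at h
  exact h

theorem measurableEmbedding_mulVec {M : Matrix ι ι ℝ} (hM : IsUnit M.det) :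
    MeasurableEmbedding (fun y : ι → ℝ => M *ᵥ y) :=
  Continuous.measurableEmbedding (by fun_prop)
    (Matrix.mulVec_injective_of_isUnit ((Matrix.isUnit_iff_isUnit_det _).mpr hM))

/-- The Fourier transform of a Gaussian with an arbitrary quadratic form of determinant one. -/
theorem integral_gaussian_mulVec {M : Matrix ι ι ℝ} (hM : |M.det| = 1) {τ : ℂ} (hτ : 0 < τ.im)
    (m : ι → ℝ) :
    Integrable (fun y : ι → ℝ => cexp (π * I * τ * ((M *ᵥ y ⬝ᵥ M *ᵥ y : ℝ) : ℂ))) ∧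
    ∫ y : ι → ℝ, cexp (-(2 * π * I * ∑ i, (m i : ℂ) * y i)) *
        cexp (π * I * τ * ((M *ᵥ y ⬝ᵥ M *ᵥ y : ℝ) : ℂ)) =
      (I / τ) ^ (Fintype.card ι / 2 : ℂ) *
        cexp (π * I * (-1 / τ) * ((M⁻¹ᵀ *ᵥ m ⬝ᵥ M⁻¹ᵀ *ᵥ m : ℝ) : ℂ)) := by
  have hdet : IsUnit M.det := by
    rw [isUnit_iff_ne_zero]
    rintro h
    simp [h] at hM
  have hτ0 : τ ≠ 0 := fun h => by simp [h] at hτ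
  have hb : 0 < (-(π * I * τ)).re := by
    simpa [Complex.mul_re, Complex.mul_im] using mul_pos Real.pi_pos hτ
  have hmp := measurePreserving_mulVec hM
  have hme := measurableEmbedding_mulVec hdet
  constructor
  · have h := GaussianFourier.integrable_cexp_neg_mul_sum_add hb (0 : ι → ℂ)
    rw [← hmp.integrable_comp_emb hme] at h
    refine h.congr (.of_forall fun y => ?_)
    simp [dotProduct, sq, -Matrix.mulVec_mulVec]
  · have h := GaussianFourier.integral_cexp_neg_mul_sum_add hb
      (fun i => -(2 * π * I) * ((M⁻¹ᵀ *ᵥ m) i : ℂ))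
    rw [← hmp.integral_comp hme] at h
    refine Eq.trans ?_ (h.trans ?_)
    · congr 1
      ext y
      rw [← Complex.exp_add]
      congr 1
      have h1 : M⁻¹ᵀ *ᵥ m ⬝ᵥ M *ᵥ y = m ⬝ᵥ y := by
        rw [mulVec_transpose, ← dotProduct_mulVec, mulVec_mulVec, nonsing_inv_mul _ hdet,
          one_mulVec]
      have h2 : (∑ i, (m i : ℂ) * y i) = ∑ i, ((M⁻¹ᵀ *ᵥ m) i : ℂ) * ((M *ᵥ y) i : ℂ) := by
        have := congrArg (fun r : ℝ => (r : ℂ)) h1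
        simp only [dotProduct] at this
        push_cast at this
        exact this.symm
      rw [h2]
      simp only [dotProduct, Finset.mul_sum, mul_assoc, sq, neg_mul, neg_neg,
        Finset.sum_neg_distrib]
      push_cast
      simp only [Finset.mul_sum]
      ring
    · congr 2
      · field_simp
        rw [I_sq]
      · simp only [dotProduct, mul_pow, ← Finset.mul_sum]
        push_cast
        simp only [← sq]
        field_simp
        ring

end Gaussian

/-! ### Unimodular lattices and the inversion formula -/

section Lattice

open Complex Matrix
open scoped Real

variable {L : Type*} [AddCommGroup L] {B : LinearMap.BilinForm ℤ L}
  {ι : Type*} [Fintype ι]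

theorem apply_eq_sum_repr (b : Module.Basis ι ℤ L) (x y : L) :
    B x y = ∑ i, B x (b i) * b.repr y i := by
  have h := congrArg (B x) (b.sum_repr y)
  simp only [map_sum, map_smul, smul_eq_mul] at h
  simp only [← h, mul_comm]

variable [DecidableEq ι]

theorem intCast_dotProduct_toMatrix_mulVec (b : Module.Basis ι ℤ L) (x y : L) :
    (fun i => (b.repr x i : ℝ)) ⬝ᵥ
      (LinearMap.BilinForm.toMatrix b B).map (Int.castRingHom ℝ) *ᵥ (fun i => (b.repr y i : ℝ)) =
      B x y := by
  have h := LinearMap.BilinForm.apply_eq_dotProduct_toMatrix_mulVec b B x y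
  rw [h]
  simp [dotProduct, mulVec]

theorem IsPosDefEvenUnimodular.nonneg (hB : IsPosDefEvenUnimodular B) (x : L) : 0 ≤ B x x := by
  by_cases hx : x = 0
  · simp [hx]
  · exact (hB.pos_def x hx).le

/-- Clearing denominators carries nonnegativity from the lattice to rational vectors, and density
carries it to real ones. -/
theorem posSemidef_toMatrix (hB : IsPosDefEvenUnimodular B) (b : Module.Basis ι ℤ L) :
    ((LinearMap.BilinForm.toMatrix b B).map (Int.castRingHom ℝ)).PosSemidef := by
  set G := (LinearMap.BilinForm.toMatrix b B).map (Int.castRingHom ℝ)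
  refine .of_dotProduct_mulVec_nonneg ?_ fun x => ?_
  · ext i j
    simp [G, LinearMap.BilinForm.toMatrix_apply, hB.symm]
  · have hclosed : IsClosed {x : ι → ℝ | 0 ≤ x ⬝ᵥ G *ᵥ x} :=
      isClosed_le continuous_const (by fun_prop)
    have hdense : DenseRange (Pi.map fun (_ : ι) (q : ℚ) => (q : ℝ)) :=
      DenseRange.piMap fun _ => Rat.denseRange_cast
    refine hdense.induction_on (p := fun x => 0 ≤ x ⬝ᵥ G *ᵥ x) x hclosed fun q => ?_
    obtain ⟨d, hd⟩ := IsLocalization.exist_integer_multiples_of_finite (nonZeroDivisors ℤ) q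
    choose n hn using hd
    have hd0 : ((d : ℤ) : ℝ) ≠ 0 := by exact_mod_cast nonZeroDivisors.ne_zero d.2
    have hq : (fun i => ((b.repr (b.equivFun.symm n)) i : ℝ)) = (d : ℤ) • Pi.map (fun _ (q : ℚ) => (q : ℝ)) q := by
      ext i
      have h1 := hn i
      have h2 : b.repr (b.equivFun.symm n) i = n i := by
        rw [← Module.Basis.equivFun_apply, LinearEquiv.apply_symm_apply]
      rw [h2]
      simp only [algebraMap_int_eq, eq_intCast, zsmul_eq_mul] at h1
      have h3 := congrArg (fun r : ℚ => (r : ℝ)) h1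
      simpa using h3
    have h := intCast_dotProduct_toMatrix_mulVec (B := B) b (b.equivFun.symm n) (b.equivFun.symm n)
    rw [hq, mulVec_smul, smul_dotProduct, dotProduct_smul, zsmul_eq_mul, zsmul_eq_mul, ← mul_assoc]
      at h
    have h0 : (0 : ℝ) ≤ B (b.equivFun.symm n) (b.equivFun.symm n) := by
      exact_mod_cast hB.nonneg _
    rw [← h] at h0
    exact nonneg_of_mul_nonneg_right h0 (mul_self_pos.mpr hd0)

/-- Lattice vectors representing the dual basis form an integral left inverse of the Gram matrix. -/
theorem isUnit_det_toMatrix (hB : IsPosDefEvenUnimodular B) (b : Module.Basis ι ℤ L) :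
    IsUnit (LinearMap.BilinForm.toMatrix b B).det := by
  choose l hl using fun i => hB.unimodular.2 (b.coord i)
  have h : (Matrix.of fun i j => b.repr (l i) j) * LinearMap.BilinForm.toMatrix b B = 1 := by
    ext i j
    have h1 := LinearMap.BilinForm.apply_eq_dotProduct_toMatrix_mulVec b B (l i) (b j)
    have h2 : B (l i) (b j) = (1 : Matrix ι ι ℤ) i j := by
      have := congrFun (congrArg DFunLike.coe (hl i)) (b j)
      rw [this]
      simp [Matrix.one_apply, Finsupp.single_apply, eq_comm]
    rw [← h2, h1, Matrix.mul_apply]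
    simp [dotProduct, Finsupp.single_eq_pi_single]
  have := congrArg Matrix.det h
  rw [det_mul, det_one] at this
  exact IsUnit.of_mul_eq_one_right _ this

open scoped MatrixOrder in
/-- An even unimodular lattice embeds isometrically into Euclidean space with covolume one. -/
theorem exists_gram_sqrt (hB : IsPosDefEvenUnimodular B) (b : Module.Basis ι ℤ L) :
    ∃ M : Matrix ι ι ℝ, |M.det| = 1 ∧
      Mᵀ * M = (LinearMap.BilinForm.toMatrix b B).map (Int.castRingHom ℝ) := by
  set G := (LinearMap.BilinForm.toMatrix b B).map (Int.castRingHom ℝ)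
  have hG := posSemidef_toMatrix hB b
  have hMM : (CFC.sqrt G)ᵀ * CFC.sqrt G = G := by
    have h : (CFC.sqrt G)ᵀ = CFC.sqrt G := by
      have := (CFC.sqrt_nonneg G).posSemidef.1
      rwa [IsHermitian, conjTranspose_eq_transpose_of_trivial] at this
    rw [h]
    exact CFC.sqrt_mul_sqrt_self G hG.nonneg
  refine ⟨CFC.sqrt G, ?_, hMM⟩
  have hdet := congrArg Matrix.det hMM
  rw [det_mul, det_transpose] at hdet
  have hGdet : G.det = (LinearMap.BilinForm.toMatrix b B).det :=
    (RingHom.map_det (Int.castRingHom ℝ) _).symm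
  rcases Int.isUnit_iff.mp (isUnit_det_toMatrix hB b) with h | h
  · rw [hGdet, h, Int.cast_one, ← sq] at hdet
    exact (sq_eq_sq₀ (abs_nonneg _) zero_le_one).mp (by rw [sq_abs, hdet, one_pow])
  · rw [hGdet, h] at hdet
    push_cast at hdet
    nlinarith [mul_self_nonneg (CFC.sqrt G).det]

theorem dotProduct_mulVec_repr {b : Module.Basis ι ℤ L} {M : Matrix ι ι ℝ}
    (hM : Mᵀ * M = (LinearMap.BilinForm.toMatrix b B).map (Int.castRingHom ℝ)) (x y : L) :
    M *ᵥ (fun i => (b.repr x i : ℝ)) ⬝ᵥ M *ᵥ (fun i => (b.repr y i : ℝ)) = B x y := by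
  rw [← intCast_dotProduct_toMatrix_mulVec b, ← hM, ← mulVec_mulVec, dotProduct_mulVec _ Mᵀ,
    vecMul_transpose]

/-- The isomorphism `x ↦ (⟨x, bᵢ⟩)ᵢ` of a unimodular lattice with `ℤ ^ ι`. -/
def dualCoordEquiv (hB : IsPosDefEvenUnimodular B) (b : Module.Basis ι ℤ L) : L ≃ (ι → ℤ) :=
  Equiv.ofBijective (fun l i => B l (b i)) ⟨fun x y h =>
    hB.unimodular.1 (b.ext fun i => congrFun h i), fun m => by
      obtain ⟨l, hl⟩ := hB.unimodular.2 (b.constr ℤ m)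
      refine ⟨l, funext fun i => ?_⟩
      exact (congrFun (congrArg DFunLike.coe hl) (b i)).trans (b.constr_basis ℤ m i)⟩

/-- Self-duality in coordinates: the frequency attached to x is the Gram matrix MᵀM applied to its
coordinates, and M⁻ᵀ cancels Mᵀ. The dual sum in Poisson's formula thus becomes a sum over the same
lattice. -/
theorem inv_transpose_mulVec_dualCoord {b : Module.Basis ι ℤ L}
    {M : Matrix ι ι ℝ} (hdet : IsUnit M.det)
    (hM : Mᵀ * M = (LinearMap.BilinForm.toMatrix b B).map (Int.castRingHom ℝ))
    (hs : ∀ x y, B x y = B y x) (x : L) :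
    M⁻¹ᵀ *ᵥ (fun i => (B x (b i) : ℝ)) = M *ᵥ fun i => (b.repr x i : ℝ) := by
  have h : (fun i => (B x (b i) : ℝ)) = Mᵀ *ᵥ M *ᵥ fun i => (b.repr x i : ℝ) := by
    rw [mulVec_mulVec, hM]
    ext i
    rw [hs, apply_eq_sum_repr b]
    simp [mulVec, dotProduct, LinearMap.BilinForm.toMatrix_apply]
  rw [h, mulVec_mulVec, ← transpose_mul, mul_nonsing_inv _ hdet, transpose_one, one_mulVec]

/-- The linear term in the exponent leaves room to dominate both the characters exp(2πiz⟨l,v⟩) and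
the weights ⟨l,v⟩². -/
theorem summable_exp_lattice (hB : IsPosDefEvenUnimodular B) (b : Module.Basis ι ℤ L)
    {T : ℝ} (hT : 0 < T) (S : ℝ) (v : L) :
    Summable fun l : L => Real.exp (-T * B l l + S * |(B l v : ℝ)|) := by
  obtain ⟨M, hdet, hM⟩ := exists_gram_sqrt hB b
  have hdet' : IsUnit M.det := by
    rw [isUnit_iff_ne_zero]
    rintro h
    simp [h] at hdet
  obtain ⟨a, ha, hle⟩ := exists_mul_sum_sq_le hdet'
  set K : ℝ := ∑ i, |(B v (b i) : ℝ)|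
  have hsum := (b.equivFun.toEquiv.summable_iff).mpr
    (summable_exp_neg_sq_add_abs (ι := ι) (mul_pos hT ha) (|S| * K))
  refine hsum.of_nonneg_of_le (fun _ => (Real.exp_pos _).le) fun l => ?_
  refine Real.exp_le_exp.mpr ?_
  have h1 := hle fun i => (b.repr l i : ℝ)
  rw [dotProduct_mulVec_repr hM] at h1
  have h2 : |(B l v : ℝ)| ≤ K * ∑ i, |(b.repr l i : ℝ)| := by
    rw [hB.symm, apply_eq_sum_repr b]
    push_cast
    refine (Finset.abs_sum_le_sum_abs _ _).trans ?_
    rw [Finset.mul_sum]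
    refine Finset.sum_le_sum fun i _ => ?_
    rw [abs_mul]
    exact mul_le_mul_of_nonneg_right
      (Finset.single_le_sum (f := fun i => |(B v (b i) : ℝ)|) (fun i _ => abs_nonneg _)
        (Finset.mem_univ i)) (abs_nonneg _)
  have h3 : S * |(B l v : ℝ)| ≤ |S| * (K * ∑ i, |(b.repr l i : ℝ)|) :=
    (mul_le_mul_of_nonneg_right (le_abs_self S) (abs_nonneg _)).trans
      (mul_le_mul_of_nonneg_left h2 (abs_nonneg S))
  have h4 := mul_le_mul_of_nonneg_left h1 hT.le
  calc -T * B l l + S * |(B l v : ℝ)|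
      ≤ -(T * (a * ∑ i, (b.repr l i : ℝ) ^ 2)) + |S| * (K * ∑ i, |(b.repr l i : ℝ)|) := by linarith
    _ = _ := by
      simp only [LinearEquiv.coe_toEquiv, Module.Basis.equivFun_apply,
        Finset.mul_sum, Finset.sum_add_distrib, ← Finset.sum_neg_distrib]
      congr 1 <;> exact Finset.sum_congr rfl fun i _ => by ring

theorem summable_cexp_mulVec_int {N : Matrix ι ι ℝ} (hN : IsUnit N.det) {τ : ℂ} (hτ : 0 < τ.im) :
    Summable fun m : ι → ℤ => cexp (π * I * τ *
      ((N *ᵥ (fun i => (m i : ℝ)) ⬝ᵥ N *ᵥ (fun i => (m i : ℝ)) : ℝ) : ℂ)) := by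
  obtain ⟨u, hu, hle⟩ := exists_summable_gaussian_bound hN hτ 0
  refine Summable.of_norm_bounded hu fun m => ?_
  have h := hle m 0 (by rw [norm_zero])
  rw [zero_add] at h
  exact h

theorem tsum_gaussian_translate_repr (hs : ∀ x y, B x y = B y x) {b : Module.Basis ι ℤ L}
    {M : Matrix ι ι ℝ}
    (hM : Mᵀ * M = (LinearMap.BilinForm.toMatrix b B).map (Int.castRingHom ℝ)) (v : L) (s : ℝ)
    (τ : ℂ) :
    ∑' n : ι → ℤ, cexp (π * I * τ * ((M *ᵥ ((s • fun i => (b.repr v i : ℝ)) +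
      fun i => (n i : ℝ)) ⬝ᵥ M *ᵥ ((s • fun i => (b.repr v i : ℝ)) + fun i => (n i : ℝ)) : ℝ) : ℂ)) =
      ∑' l : L, cexp (π * I * τ * (B l l + 2 * s * B l v + s ^ 2 * B v v)) := by
  rw [← b.equivFun.toEquiv.tsum_eq]
  refine tsum_congr fun l => ?_
  have h : M *ᵥ ((s • fun i => (b.repr v i : ℝ)) + fun i => (b.repr l i : ℝ)) ⬝ᵥ
      M *ᵥ ((s • fun i => (b.repr v i : ℝ)) + fun i => (b.repr l i : ℝ)) =
      B l l + 2 * s * B l v + s ^ 2 * B v v := by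
    rw [mulVec_add, mulVec_smul]
    simp only [dotProduct_add, add_dotProduct, dotProduct_smul, smul_dotProduct, smul_eq_mul,
      dotProduct_mulVec_repr hM]
    rw [hs v l]
    ring
  simp only [LinearEquiv.coe_toEquiv, Module.Basis.equivFun_apply, h]
  push_cast
  rfl

/-- The rank makes the exponent the integer 12k, and I^12 = 1, so the automorphy factor carries no
root of unity. -/
theorem pow_mul_div_cpow_eq_one {τ : ℂ} (hτ0 : τ ≠ 0) {n k : ℕ} (hk : n = 24 * k) :
    τ ^ (12 * k) * (I / τ) ^ (n / 2 : ℂ) = 1 := by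
  rw [hk, show (((24 * k : ℕ) : ℂ) / 2) = ((12 * k : ℕ) : ℂ) by push_cast; ring, cpow_natCast,
    div_pow, pow_mul I, show I ^ 12 = 1 by rw [show 12 = 4 * 3 by rfl, pow_mul, I_pow_four, one_pow],
    one_pow]
  field_simp

theorem neg_one_div_im_pos {τ : ℂ} (hτ : 0 < τ.im) : 0 < (-1 / τ).im := by
  have hτ0 : τ ≠ 0 := fun h => by simp [h] at hτ
  have := Complex.normSq_pos.mpr hτ0
  simp only [neg_div, one_div, neg_im, inv_im, neg_neg]
  positivity

/-- The inversion formula for the theta series of a shifted even unimodular lattice. -/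
theorem hasSum_theta_inversion (hB : IsPosDefEvenUnimodular B) (b : Module.Basis ι ℤ L) {k : ℕ}
    (hk : Fintype.card ι = 24 * k) (v : L) (s : ℝ) {τ : ℂ} (hτ : 0 < τ.im) :
    HasSum (fun l : L => cexp (π * I * (-1 / τ) * B l l + 2 * π * I * s * B l v))
      (τ ^ (12 * k) * ∑' l : L, cexp (π * I * τ * (B l l + 2 * s * B l v + s ^ 2 * B v v))) := by
  obtain ⟨M, hdet, hM⟩ := exists_gram_sqrt hB b
  have hdet' : IsUnit M.det := by
    rw [isUnit_iff_ne_zero]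
    rintro h
    simp [h] at hdet
  have hNdet : IsUnit M⁻¹ᵀ.det := by
    rw [det_transpose]
    exact (isUnit_nonsing_inv_det_iff).mpr hdet'
  have hτ0 : τ ≠ 0 := fun h => by simp [h] at hτ
  have hpow := pow_mul_div_cpow_eq_one hτ0 hk
  have hint := integral_gaussian_mulVec hdet hτ
  have h := hasSum_fourier_tsum
    (f := fun y : ι → ℝ => cexp (π * I * τ * ((M *ᵥ y ⬝ᵥ M *ᵥ y : ℝ) : ℂ)))
    (by fun_prop) (hint 0).1
    (exists_summable_gaussian_bound hdet' hτ)
    (fun m => (by simpa only [ofReal_intCast] using (hint fun i => (m i : ℝ)).2))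
    ((summable_cexp_mulVec_int hNdet (neg_one_div_im_pos hτ)).mul_left _)
    (s • fun i => (b.repr v i : ℝ))
  rw [tsum_gaussian_translate_repr hB.symm hM] at h
  have h2 := ((dualCoordEquiv hB b).hasSum_iff.mpr h).mul_left (τ ^ (12 * k))
  have h4 : ∀ l : L, τ ^ (12 * k) * ((I / τ) ^ (Fintype.card ι / 2 : ℂ) * cexp (π * I * (-1 / τ) *
      ((M⁻¹ᵀ *ᵥ (fun i => ((dualCoordEquiv hB b l i : ℤ) : ℝ)) ⬝ᵥ
        M⁻¹ᵀ *ᵥ (fun i => ((dualCoordEquiv hB b l i : ℤ) : ℝ)) : ℝ) : ℂ)) *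
      cexp (2 * π * I * ∑ i, (dualCoordEquiv hB b l i : ℂ) *
        ((s • fun i => (b.repr v i : ℝ)) i : ℝ))) =
      cexp (π * I * (-1 / τ) * B l l + 2 * π * I * s * B l v) := fun l => by
    have h3 : M⁻¹ᵀ *ᵥ (fun i => ((dualCoordEquiv hB b l i : ℤ) : ℝ)) =
        M *ᵥ fun i => (b.repr l i : ℝ) := inv_transpose_mulVec_dualCoord hdet' hM hB.symm l
    rw [h3, dotProduct_mulVec_repr hM, ← mul_assoc, ← mul_assoc, hpow, one_mul, ← Complex.exp_add,
      ofReal_intCast, apply_eq_sum_repr b l v, Int.cast_sum, Finset.mul_sum, Finset.mul_sum]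
    congr 2
    refine Finset.sum_congr rfl fun i _ => ?_
    rw [Pi.smul_apply, smul_eq_mul, Int.cast_mul, ofReal_mul, ofReal_intCast]
    rw [show dualCoordEquiv hB b l i = B l (b i) from rfl]
    ring
  exact (funext h4) ▸ h2

end Lattice

/-! ### Second-order expansion of the Jacobi theta function at z = 0 -/

section Jacobi

open Complex Filter
open scoped Real Topology

variable {L : Type*} [AddCommGroup L] {B : LinearMap.BilinForm ℤ L}
  {ι : Type*} [Fintype ι] [DecidableEq ι]

/-- The sum `∑ₗ exp (πiτ⟨l, l⟩ + 2πiz⟨l, v⟩)`. -/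
def jacobiSum (B : LinearMap.BilinForm ℤ L) (v : L) (τ z : ℂ) : ℂ :=
  ∑' l : L, cexp (π * I * τ * B l l + 2 * π * I * z * B l v)

/-- The sum `∑ₗ ⟨l, v⟩² exp (πiτ⟨l, l⟩)`. -/
def quadSum (B : LinearMap.BilinForm ℤ L) (v : L) (τ : ℂ) : ℂ :=
  ∑' l : L, (B l v : ℂ) ^ 2 * cexp (π * I * τ * B l l)

theorem norm_sinh_le (y : ℂ) : ‖Complex.sinh y‖ ≤ ‖y‖ * Real.exp ‖y‖ := by
  have h1 := Complex.norm_exp_sub_sum_le_norm_mul_exp y 1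
  have h2 := Complex.norm_exp_sub_sum_le_norm_mul_exp (-y) 1
  simp only [Finset.range_one, Finset.sum_singleton, pow_zero, Nat.factorial_zero, Nat.cast_one,
    div_one, pow_one, norm_neg] at h1 h2
  have h3 : Complex.sinh y = ((cexp y - 1) - (cexp (-y) - 1)) / 2 := by
    rw [Complex.sinh]
    ring
  rw [h3, norm_div, Complex.norm_ofNat, div_le_iff₀ two_pos]
  linarith [norm_sub_le (cexp y - 1) (cexp (-y) - 1)]

theorem exp_two_mul_add_exp_neg_sub_two (y : ℂ) :
    cexp (2 * y) + cexp (-(2 * y)) - 2 = 4 * Complex.sinh y ^ 2 := by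
  have h : cexp y * cexp (-y) = 1 := by rw [← Complex.exp_add, add_neg_cancel, Complex.exp_zero]
  rw [show -(2 * y) = -y + -y by ring, two_mul, Complex.exp_add, Complex.exp_add, Complex.sinh]
  linear_combination 2 * h

theorem tendsto_sinh_mul_div (c : ℂ) :
    Tendsto (fun z : ℂ => Complex.sinh (c * z) / z) (𝓝[≠] 0) (𝓝 c) := by
  have h : HasDerivAt (fun z : ℂ => Complex.sinh (c * z)) c 0 := by
    simpa using ((hasDerivAt_id (0 : ℂ)).const_mul c).csinh
  refine (hasDerivAt_iff_tendsto_slope_zero.mp h).congr fun z => ?_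
  simp [div_eq_inv_mul]

theorem norm_cexp_pi_mul_I_add (τ z : ℂ) (r t : ℝ) :
    ‖cexp (π * I * τ * r + 2 * π * I * z * t)‖ ≤
      Real.exp (-(π * τ.im) * r + 2 * π * ‖z‖ * |t|) := by
  rw [Complex.exp_add, norm_mul, norm_cexp_pi_mul_I, Real.exp_add]
  refine mul_le_mul_of_nonneg_left ?_ (Real.exp_pos _).le
  refine (Complex.norm_exp_le_exp_norm _).trans (Real.exp_le_exp.mpr (le_of_eq ?_))
  simp [abs_of_pos Real.pi_pos]

theorem summable_jacobiSum (hB : IsPosDefEvenUnimodular B) (b : Module.Basis ι ℤ L) (v : L)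
    {τ : ℂ} (hτ : 0 < τ.im) (z : ℂ) :
    Summable fun l : L => cexp (π * I * τ * B l l + 2 * π * I * z * B l v) := by
  refine .of_norm_bounded (summable_exp_lattice hB b (mul_pos Real.pi_pos hτ) (2 * π * ‖z‖) v)
    fun l => ?_
  simpa only [ofReal_intCast] using norm_cexp_pi_mul_I_add τ z (B l l) (B l v)

/-- The symmetric second difference stands in for the second derivative in z: each term becomes a
multiple of (sinh(πi⟨l,v⟩z)/z)², and dominated convergence applies for |z| ≤ 1. -/
theorem tendsto_jacobiSum_secondDiff (hB : IsPosDefEvenUnimodular B) (b : Module.Basis ι ℤ L)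
    (v : L) {τ : ℂ} (hτ : 0 < τ.im) :
    Tendsto (fun z => (jacobiSum B v τ z + jacobiSum B v τ (-z) - 2 * jacobiSum B v τ 0) / z ^ 2)
      (𝓝[≠] 0) (𝓝 ((2 * π * I) ^ 2 * quadSum B v τ)) := by
  have hT := mul_pos Real.pi_pos hτ
  have hterm : ∀ z : ℂ, (jacobiSum B v τ z + jacobiSum B v τ (-z) - 2 * jacobiSum B v τ 0) / z ^ 2 =
      ∑' l : L, cexp (π * I * τ * B l l) * 4 * (Complex.sinh (π * I * B l v * z) / z) ^ 2 := by
    intro z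
    have h1 := (summable_jacobiSum hB b v hτ z).hasSum
    have h2 := (summable_jacobiSum hB b v hτ (-z)).hasSum
    have h3 := (summable_jacobiSum hB b v hτ 0).hasSum
    refine (((((h1.add h2).sub (h3.mul_left 2)).div_const (z ^ 2))).congr_fun fun l => ?_).tsum_eq.symm
    have h4 := exp_two_mul_add_exp_neg_sub_two (π * I * B l v * z)
    rw [div_pow, mul_div_assoc', mul_assoc, ← h4, Complex.exp_add, Complex.exp_add, Complex.exp_add]
    congr 1
    rw [show 2 * π * I * z * B l v = 2 * (π * I * B l v * z) by ring,
      show 2 * π * I * -z * B l v = -(2 * (π * I * B l v * z)) by ring]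
    simp
    ring
  have hlim : (2 * π * I) ^ 2 * quadSum B v τ =
      ∑' l : L, cexp (π * I * τ * B l l) * 4 * (π * I * B l v) ^ 2 := by
    rw [quadSum, ← tsum_mul_left]
    exact tsum_congr fun l => by ring
  rw [hlim]
  refine Tendsto.congr (fun z => (hterm z).symm) ?_
  refine tendsto_tsum_of_dominated_convergence
    -- For |z| ≤ 1 the sinh quotient is at most exp(2π|⟨l,v⟩|), and it enters squared.
    ((summable_exp_lattice hB b hT (2 * π + 2 * π) v).mul_left 4)
    (fun l => ((tendsto_sinh_mul_div _).pow 2).const_mul _) ?_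
  have hball : ∀ᶠ z : ℂ in 𝓝[≠] 0, ‖z‖ ≤ 1 :=
    nhdsWithin_le_nhds (continuous_norm.tendsto' (0 : ℂ) 0 norm_zero |>.eventually_le_const one_pos)
  filter_upwards [hball, self_mem_nhdsWithin] with z hz hz0 l
  have hz0' : 0 < ‖z‖ := norm_pos_iff.mpr hz0
  have h1 : ‖Complex.sinh (π * I * B l v * z) / z‖ ≤
      Real.exp (π * |(B l v : ℝ)|) * Real.exp (π * |(B l v : ℝ)|) := by
    rw [norm_div, div_le_iff₀ hz0']
    refine (norm_sinh_le _).trans ?_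
    have h2 : ‖(π * I * B l v * z : ℂ)‖ = π * |(B l v : ℝ)| * ‖z‖ := by
      simp [abs_of_pos Real.pi_pos]
    have h3 : 0 ≤ π * |(B l v : ℝ)| := by positivity
    rw [h2]
    calc π * |(B l v : ℝ)| * ‖z‖ * Real.exp (π * |(B l v : ℝ)| * ‖z‖)
        ≤ Real.exp (π * |(B l v : ℝ)|) * ‖z‖ * Real.exp (π * |(B l v : ℝ)|) := by
          refine mul_le_mul (mul_le_mul_of_nonneg_right ?_ hz0'.le)
            (Real.exp_le_exp.mpr (mul_le_of_le_one_right h3 hz)) (Real.exp_pos _).le (by positivity)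
          linarith [Real.add_one_le_exp (π * |(B l v : ℝ)|)]
      _ = _ := by ring
  have h5 : ‖cexp (π * I * τ * B l l)‖ = Real.exp (-(π * τ.im) * B l l) := by
    simpa only [ofReal_intCast] using norm_cexp_pi_mul_I (τ := τ) (B l l)
  rw [norm_mul, norm_mul, norm_pow, h5, Complex.norm_ofNat]
  calc Real.exp (-(π * τ.im) * B l l) * 4 * ‖Complex.sinh (π * I * B l v * z) / z‖ ^ 2
      ≤ Real.exp (-(π * τ.im) * B l l) * 4 *
        (Real.exp (π * |(B l v : ℝ)|) * Real.exp (π * |(B l v : ℝ)|)) ^ 2 := by gcongr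
    _ = 4 * Real.exp (-(π * τ.im) * B l l + (2 * π + 2 * π) * |(B l v : ℝ)|) := by
      rw [← Real.exp_add, ← Real.exp_nat_mul, Real.exp_add]
      rw [mul_comm _ (4 : ℝ), mul_assoc]
      congr 3
      push_cast
      ring

/-- Expanding ⟨l+sv, l+sv⟩ in the translated sum produces the argument τs and the Gaussian factor.
The parameter s is real because Poisson summation is evaluated at the real point sv. -/
theorem jacobiSum_inversion (hB : IsPosDefEvenUnimodular B) (b : Module.Basis ι ℤ L) {k : ℕ}
    (hk : Fintype.card ι = 24 * k) (v : L) (s : ℝ) {τ : ℂ} (hτ : 0 < τ.im) :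
    jacobiSum B v (-1 / τ) s =
      τ ^ (12 * k) * (cexp (π * I * τ * B v v * s ^ 2) * jacobiSum B v τ (τ * s)) := by
  rw [jacobiSum, (hasSum_theta_inversion hB b hk v s hτ).tsum_eq, jacobiSum]
  congr 1
  rw [← tsum_mul_left]
  refine tsum_congr fun l => ?_
  rw [← Complex.exp_add]
  congr 1
  ring

/-- Compare second differences of `jacobiSum_inversion` as s → 0 through real values. The Gaussian
factor contributes the extra multiple of the theta series, the failure of modularity that E₂ will
repair. -/
theorem quadSum_inversion (hB : IsPosDefEvenUnimodular B) (b : Module.Basis ι ℤ L) {k : ℕ}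
    (hk : Fintype.card ι = 24 * k) (v : L) {τ : ℂ} (hτ : 0 < τ.im) :
    (2 * π * I) ^ 2 * quadSum B v (-1 / τ) =
      τ ^ (12 * k) * (τ ^ 2 * ((2 * π * I) ^ 2 * quadSum B v τ) +
        2 * (π * I * τ * B v v) * jacobiSum B v τ 0) := by
  have hτ0 : τ ≠ 0 := fun h => by simp [h] at hτ
  have hs : Tendsto (fun s : ℝ => (s : ℂ)) (𝓝[≠] 0) (𝓝[≠] (0 : ℂ)) := by
    refine tendsto_nhdsWithin_iff.mpr ⟨?_, ?_⟩
    · exact (Complex.continuous_ofReal.tendsto' 0 0 ofReal_zero).mono_left nhdsWithin_le_nhds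
    · filter_upwards [self_mem_nhdsWithin] with s hs
      simpa using hs
  have hτs : Tendsto (fun s : ℝ => τ * (s : ℂ)) (𝓝[≠] 0) (𝓝[≠] 0) := by
    refine tendsto_nhdsWithin_iff.mpr ⟨?_, ?_⟩
    · exact ((by fun_prop : Continuous fun s : ℝ => τ * (s : ℂ)).tendsto' 0 0 (by simp)).mono_left
        nhdsWithin_le_nhds
    · filter_upwards [self_mem_nhdsWithin] with s hs
      simpa [hτ0] using hs
  set c : ℂ := π * I * τ * B v v
  have hexp : Tendsto (fun s : ℝ => (cexp (c * (s : ℂ) ^ 2) - 1) / (s : ℂ) ^ 2) (𝓝[≠] 0) (𝓝 c) := by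
    have h : HasDerivAt (fun z : ℂ => cexp (c * z)) c 0 := by
      simpa using ((hasDerivAt_id (0 : ℂ)).const_mul c).cexp
    have h1 := hasDerivAt_iff_tendsto_slope_zero.mp h
    have h2 : Tendsto (fun s : ℝ => (s : ℂ) ^ 2) (𝓝[≠] 0) (𝓝[≠] 0) := by
      refine tendsto_nhdsWithin_iff.mpr ⟨?_, ?_⟩
      · exact ((by fun_prop : Continuous fun s : ℝ => (s : ℂ) ^ 2).tendsto' 0 0 (by simp)).mono_left
          nhdsWithin_le_nhds
      · filter_upwards [self_mem_nhdsWithin] with s hs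
        simpa using hs
    refine (h1.comp h2).congr fun s => ?_
    simp [div_eq_inv_mul]
  have hexp1 : Tendsto (fun s : ℝ => cexp (c * (s : ℂ) ^ 2)) (𝓝[≠] 0) (𝓝 1) :=
    ((by fun_prop : Continuous fun s : ℝ => cexp (c * (s : ℂ) ^ 2)).tendsto' 0 1 (by simp)).mono_left
      nhdsWithin_le_nhds
  have hleft := (tendsto_jacobiSum_secondDiff hB b v (neg_one_div_im_pos hτ)).comp hs
  have hright := (((hexp1.mul (((tendsto_jacobiSum_secondDiff hB b v hτ).comp hτs).const_mul
    (τ ^ 2))).add ((hexp.const_mul 2).mul_const (jacobiSum B v τ 0))).const_mul (τ ^ (12 * k)))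
  rw [one_mul] at hright
  refine tendsto_nhds_unique_of_eventuallyEq hleft hright ?_
  filter_upwards [self_mem_nhdsWithin] with s hs
  have hs0 : (s : ℂ) ≠ 0 := by simpa using hs
  have h1 := jacobiSum_inversion hB b hk v s hτ
  have h2 := jacobiSum_inversion hB b hk v (-s) hτ
  have h3 := jacobiSum_inversion hB b hk v 0 hτ
  push_cast at h2 h3
  rw [neg_sq, mul_neg] at h2
  rw [mul_zero, zero_pow two_ne_zero, mul_zero, Complex.exp_zero, one_mul] at h3
  simp only [Function.comp_apply]
  rw [h1, h2, h3]
  change _ = τ ^ (12 * k) * (cexp (π * I * τ * B v v * s ^ 2) * _ + _ * ((cexp (π * I * τ * B v v * s ^ 2) - 1) / _) * _)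
  generalize cexp (π * I * τ * B v v * s ^ 2) = e
  field_simp
  ring

end Jacobi

/-! ### Modularity of the theta series -/

section ThetaSeries

open Complex PowerSeries
open UpperHalfPlane hiding I
open scoped Real MatrixGroups ModularForm

variable {L : Type*} [AddCommGroup L] [Module.Free ℤ L] [Module.Finite ℤ L]
  {B : LinearMap.BilinForm ℤ L}

/-- The theta series `∑ₗ w(l) q^(⟨l, l⟩ / 2)` with weights `w`. -/
def weightedTheta (hB : IsPosDefEvenUnimodular B) (w : L → ℤ) : ℤ⟦X⟧ :=
  PowerSeries.mk fun n => ∑ l ∈ (hB.finite_shell (2 * (n : ℤ))).toFinset, w l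

theorem weightedTheta_one (hB : IsPosDefEvenUnimodular B) :
    weightedTheta hB (fun _ => 1) = theta B := by
  ext n
  rw [weightedTheta, theta, coeff_mk, coeff_mk, Set.ncard_eq_toFinset_card _ (hB.finite_shell _)]
  simp

theorem hasQExpansion_weightedTheta (hB : IsPosDefEvenUnimodular B) {w : L → ℤ} {f : ℍ → ℂ}
    (hf : ∀ τ : ℍ, HasSum (fun l => (w l : ℂ) * cexp (π * I * τ * B l l)) (f τ)) :
    HasQExpansion f (PowerSeries.map (Int.castRingHom ℂ) (weightedTheta hB w)) := fun τ => by
  refine ((hf τ).tsum_fiberwise fun l => (B l l / 2).toNat).congr_fun fun n => ?_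
  -- Evenness and nonnegativity make both the division by 2 and `toNat` lossless.
  have hset : (fun l => (B l l / 2).toNat) ⁻¹' {n} =
      ((hB.finite_shell (2 * (n : ℤ))).toFinset : Set L) := by
    ext l
    have h1 := hB.nonneg l
    obtain ⟨r, hr⟩ := hB.even l
    simp only [Set.mem_preimage, Set.mem_singleton_iff, Set.Finite.coe_toFinset, Set.mem_ofPred_eq]
    omega
  rw [hset, Finset.tsum_subtype' _ fun l => (w l : ℂ) * cexp (π * I * τ * B l l), coeff_map,
    weightedTheta, coeff_mk, eq_intCast, Int.cast_sum, Finset.sum_smul]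
  refine Finset.sum_congr rfl fun l hl => ?_
  have hl' : B l l = 2 * (n : ℤ) := by simpa using hl
  rw [hl', smul_eq_mul, Function.Periodic.qParam, ← Complex.exp_nat_mul]
  congr 2
  push_cast
  ring

variable {ι : Type*} [Fintype ι] [DecidableEq ι]

theorem hasQExpansion_theta (hB : IsPosDefEvenUnimodular B) (b : Module.Basis ι ℤ L) (v : L) :
    HasQExpansion (fun τ => jacobiSum B v τ 0) (PowerSeries.map (Int.castRingHom ℂ) (theta B)) := by
  rw [← weightedTheta_one hB]
  refine hasQExpansion_weightedTheta hB fun τ => ?_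
  refine (summable_jacobiSum hB b v τ.2 0).hasSum.congr_fun fun l => ?_
  simp

theorem hasQExpansion_quadSum (hB : IsPosDefEvenUnimodular B) (b : Module.Basis ι ℤ L) (v : L) :
    HasQExpansion (fun τ => quadSum B v τ)
      (PowerSeries.map (Int.castRingHom ℂ) (weightedTheta hB fun l => B l v * B l v)) := by
  refine hasQExpansion_weightedTheta hB fun τ => ?_
  have h : Summable fun l : L => (B l v : ℂ) ^ 2 * cexp (π * I * τ * B l l) := by
    refine .of_norm_bounded (summable_exp_lattice hB b (mul_pos Real.pi_pos τ.2) 2 v) fun l => ?_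
    have h5 : ‖cexp (π * I * τ * B l l)‖ = Real.exp (-(π * (τ : ℂ).im) * B l l) := by
      simpa only [ofReal_intCast] using norm_cexp_pi_mul_I (τ := τ) (B l l)
    have h6 : ‖(B l v : ℂ)‖ ≤ Real.exp |(B l v : ℝ)| := by
      rw [Complex.norm_intCast]
      linarith [Real.add_one_le_exp |(B l v : ℝ)|]
    rw [norm_mul, norm_pow, h5, add_comm, Real.exp_add, two_mul, Real.exp_add, ← sq]
    gcongr
  refine h.hasSum.congr_fun fun l => ?_
  push_cast
  ring

theorem slash_S_eq_of_forall {f : ℍ → ℂ} {k : ℕ}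
    (hf : ∀ τ : ℍ, f (ModularGroup.S • τ) = (τ : ℂ) ^ k * f τ) :
    f ∣[(k : ℤ)] ModularGroup.S = f := by
  ext τ
  rw [ModularForm.SL_slash_apply, hf, ModularGroup.denom_S, zpow_neg, zpow_natCast]
  have := pow_ne_zero k τ.ne_zero
  field_simp

theorem coe_S_smul (τ : ℍ) : ((ModularGroup.S • τ : ℍ) : ℂ) = -1 / τ := by
  rw [modular_S_smul]
  simp [neg_div, inv_neg]

theorem E2_S_smul (τ : ℍ) : EisensteinSeries.E2 (ModularGroup.S • τ) =
    (τ : ℂ) ^ 2 * EisensteinSeries.E2 τ + 6 * τ / (π * I) := by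
  have h := congrFun (EisensteinSeries.E2_slash_action ModularGroup.S) τ
  rw [ModularForm.SL_slash_apply, ModularGroup.denom_S] at h
  simp only [Pi.sub_apply, Pi.smul_apply, EisensteinSeries.D2_S, riemannZeta_two, smul_eq_mul] at h
  have hτ := τ.ne_zero
  have hπ : (π : ℂ) ≠ 0 := ofReal_ne_zero.mpr Real.pi_ne_zero
  rw [zpow_neg, mul_inv_eq_iff_eq_mul₀ (zpow_ne_zero _ hτ)] at h
  rw [h, show ((2 : ℤ)) = ((2 : ℕ) : ℤ) by rfl, zpow_natCast]
  field_simp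
  linear_combination -6 * I_sq

/-- The theta series of an even unimodular lattice of rank `24 k` is a modular form. -/
theorem exists_modularForm_theta (hB : IsPosDefEvenUnimodular B) (b : Module.Basis ι ℤ L) {k : ℕ}
    (hk : Fintype.card ι = 24 * k) :
    ∃ F : ModularForm 𝒮ℒ ((12 * k : ℕ) : ℤ),
      qExpansion 1 F = PowerSeries.map (Int.castRingHom ℂ) (theta B) := by
  have hq := hasQExpansion_theta hB b 0
  obtain ⟨F, hF⟩ := hq.exists_modularForm (k := ((12 * k : ℕ) : ℤ))
    (slash_S_eq_of_forall fun τ => by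
      have h := jacobiSum_inversion hB b hk 0 0 τ.2
      rw [coe_S_smul]
      simpa using h)
  exact ⟨F, HasQExpansion.qExpansion_eq (hF ▸ hq)⟩

/-- The theta series with weights `⟨l, v⟩²`, corrected by a multiple of `E₂` times the theta
series, is a modular form. -/
theorem exists_modularForm_quadSum (hB : IsPosDefEvenUnimodular B) (b : Module.Basis ι ℤ L)
    {k : ℕ} (hk : Fintype.card ι = 24 * k) (v : L) :
    ∃ F : ModularForm 𝒮ℒ ((12 * k + 2 : ℕ) : ℤ),
      qExpansion 1 F = PowerSeries.map (Int.castRingHom ℂ) (weightedTheta hB fun l => B l v * B l v) -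
        ((B v v : ℂ) / 12) • (PowerSeries.map (Int.castRingHom ℂ) c₂ *
          PowerSeries.map (Int.castRingHom ℂ) (theta B)) := by
  have hq := (hasQExpansion_quadSum hB b v).sub
    ((hasQExpansion_E2.mul (hasQExpansion_theta hB b v)).const_smul ((B v v : ℂ) / 12))
  obtain ⟨F, hF⟩ := hq.exists_modularForm (k := ((12 * k + 2 : ℕ) : ℤ))
    (slash_S_eq_of_forall fun τ => by
      have h1 := jacobiSum_inversion hB b hk v 0 τ.2
      have h2 := quadSum_inversion hB b hk v τ.2
      have hπ : (π : ℂ) ≠ 0 := ofReal_ne_zero.mpr Real.pi_ne_zero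
      -- The E₂ anomaly 6τ/(πi), times ⟨v,v⟩/12, is τ⟨v,v⟩/(2πi), exactly the extra term in
      -- `quadSum_inversion` after division by (2πi)².
      simp only [Pi.sub_apply, Pi.smul_apply, Pi.mul_apply, smul_eq_mul, E2_S_smul, coe_S_smul]
      simp only [ofReal_zero, mul_zero, zero_pow two_ne_zero, Complex.exp_zero, one_mul] at h1
      rw [h1]
      have h3 : quadSum B v (-1 / τ) = ((2 * π * I) ^ 2)⁻¹ * ((2 * π * I) ^ 2 * quadSum B v (-1 / τ)) := by
        field_simp
      rw [h3, h2]
      field_simp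
      ring)
  exact ⟨F, HasQExpansion.qExpansion_eq (hF ▸ hq)⟩

end ThetaSeries

/-! ### The congruence modulo 24 -/

section Congruence

open PowerSeries

variable {L : Type*} [AddCommGroup L] {B : LinearMap.BilinForm ℤ L}

theorem constantCoeff_theta (hB : IsPosDefEvenUnimodular B) : constantCoeff (theta B) = 1 := by
  rw [← coeff_zero_eq_constantCoeff_apply, theta, coeff_mk]
  have : {l : L | B l l = 2 * ((0 : ℕ) : ℤ)} = {0} := by
    ext l
    simp only [Nat.cast_zero, mul_zero, Set.mem_ofPred_eq, Set.mem_singleton_iff]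
    refine ⟨fun h => ?_, fun h => by simp [h]⟩
    by_contra h0
    exact (hB.pos_def l h0).ne' h
  rw [this, Set.ncard_singleton, Nat.cast_one]

variable [Module.Free ℤ L] [Module.Finite ℤ L]

theorem weightedTheta_add (hB : IsPosDefEvenUnimodular B) (w₁ w₂ : L → ℤ) :
    weightedTheta hB (w₁ + w₂) = weightedTheta hB w₁ + weightedTheta hB w₂ := by
  ext n
  simp [weightedTheta, Finset.sum_add_distrib]

/-- An even weight that vanishes at `0` gives a theta series with even coefficients. -/
theorem exists_weightedTheta_eq_two_mul (hB : IsPosDefEvenUnimodular B) {w : L → ℤ} (h0 : w 0 = 0)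
    (hw : ∀ l, w (-l) = w l) : ∃ g : ℤ⟦X⟧, weightedTheta hB w = 2 * g := by
  have h : ∀ n, ∃ m : ℤ, coeff n (weightedTheta hB w) = 2 * m := fun n => by
    refine dvd_iff_exists_eq_mul_right.mp ((ZMod.intCast_zmod_eq_zero_iff_dvd _ 2).mp ?_)
    rw [weightedTheta, coeff_mk, Int.cast_sum]
    -- Modulo 2 the terms of l and -l cancel; as L is torsion-free the only fixed point is 0, where
    -- the weight vanishes.
    refine Finset.sum_involution (fun l _ => -l) (fun l _ => ?_) (fun l _ hl hneg => hl ?_)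
      (fun l hl => ?_) fun l _ => neg_neg l
    · rw [hw]
      exact CharTwo.add_self_eq_zero _
    · have hl2 : (2 : ℤ) • l = 0 := by
        rw [two_smul, ← sub_neg_eq_add, hneg, sub_self]
      rw [(smul_eq_zero_iff_right two_ne_zero).mp hl2, h0, Int.cast_zero]
    · simpa using hl
  choose m hm using h
  refine ⟨PowerSeries.mk m, ?_⟩
  ext n
  rw [hm, two_mul, two_mul, map_add, coeff_mk]

theorem twelve_mul_coeff_weightedTheta (hB : IsPosDefEvenUnimodular B) {k : ℕ}
    (hL : Module.finrank ℤ L = 24 * k) {U V : ℤ⟦X⟧} (hΔ : Δ = X * U) (hUV : U * V = 1) (v : L) :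
    12 * coeff k (weightedTheta hB (fun l => B l v * B l v) * V ^ k) =
      B v v * coeff k (c₂ * theta B * V ^ k) := by
  classical
  obtain ⟨F, hF⟩ := exists_modularForm_quadSum hB (Module.Free.chooseBasis ℤ L) (k := k)
    ((Module.finrank_eq_card_chooseBasisIndex ℤ L).symm.trans hL) v
  have h := coeff_qExpansion_mul_pow_eq_zero hΔ hUV k (by push_cast; rfl) F
  rw [hF, sub_mul, smul_mul_assoc, ← map_mul, ← map_pow, ← map_mul, ← map_mul, map_sub,
    map_smul, coeff_map, coeff_map, eq_intCast, eq_intCast, smul_eq_mul, sub_eq_zero] at h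
  have h' : (12 : ℂ) * (coeff k (weightedTheta hB (fun l => B l v * B l v) * V ^ k) : ℤ) =
      (B v v : ℂ) * (coeff k (c₂ * theta B * V ^ k) : ℤ) := by
    rw [h]
    ring
  exact_mod_cast h'

/-- Polarisation is needed because ⟨v,v⟩ is always even: the diagonal identity alone would lose a
factor 2, whereas ⟨v,w⟩ can equal 1. -/
theorem twelve_mul_coeff_weightedTheta_polar (hB : IsPosDefEvenUnimodular B) {k : ℕ}
    (hL : Module.finrank ℤ L = 24 * k) {U V : ℤ⟦X⟧} (hΔ : Δ = X * U) (hUV : U * V = 1) (v w : L) :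
    12 * coeff k (weightedTheta hB (fun l => B l v * B l w) * V ^ k) =
      B v w * coeff k (c₂ * theta B * V ^ k) := by
  have h1 := twelve_mul_coeff_weightedTheta hB hL hΔ hUV v
  have h2 := twelve_mul_coeff_weightedTheta hB hL hΔ hUV w
  have h3 := twelve_mul_coeff_weightedTheta hB hL hΔ hUV (v + w)
  have h4 : (fun l => B l (v + w) * B l (v + w)) = (fun l => B l v * B l v) +
      ((fun l => B l w * B l w) + ((fun l => B l v * B l w) + fun l => B l v * B l w)) := by
    ext l
    simp only [map_add, Pi.add_apply]
    ring
  have h5 : B (v + w) (v + w) = B v v + B w w + 2 * B v w := by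
    simp only [map_add, LinearMap.add_apply, hB.symm w v]
    ring
  rw [h4, h5] at h3
  simp only [weightedTheta_add, add_mul, map_add] at h3
  linarith

theorem exists_apply_eq_one (hB : IsPosDefEvenUnimodular B) (hL : 0 < Module.finrank ℤ L) :
    ∃ v w, B v w = 1 := by
  let b := Module.Free.chooseBasis ℤ L
  rw [Module.finrank_eq_card_chooseBasisIndex, Fintype.card_pos_iff] at hL
  obtain ⟨i⟩ := hL
  obtain ⟨v, hv⟩ := hB.unimodular.2 (b.coord i)
  refine ⟨v, b i, ?_⟩
  have := congrFun (congrArg DFunLike.coe hv) (b i)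
  simpa using this

/-- The factor 12 comes from the weight 12k+2 identity and the factor 2 from the symmetry l ↦ -l;
replacing E₂θ by θ changes the coefficient by a multiple of 24. -/
theorem dvd_coeff_theta_mul_pow (hB : IsPosDefEvenUnimodular B) {k : ℕ} (hk : 1 ≤ k)
    (hL : Module.finrank ℤ L = 24 * k) {U V : ℤ⟦X⟧} (hΔ : Δ = X * U) (hUV : U * V = 1) :
    24 ∣ coeff k (theta B * V ^ k) := by
  obtain ⟨v, w, hvw⟩ := exists_apply_eq_one hB (by omega)
  have h1 := twelve_mul_coeff_weightedTheta_polar hB hL hΔ hUV v w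
  obtain ⟨g, hg⟩ := exists_weightedTheta_eq_two_mul hB (w := fun l => B l v * B l w) (by simp)
    (fun l => by simp)
  have h2 : ∀ f : ℤ⟦X⟧, ∀ n : ℤ, coeff k (C n * f) = n * coeff k f := fun f n => coeff_C_mul _ _ _
  have h24 : (24 : ℤ⟦X⟧) = C 24 := (map_ofNat C 24).symm
  have h22 : (2 : ℤ⟦X⟧) = C 2 := (map_ofNat C 2).symm
  rw [hvw, one_mul, hg, mul_assoc, h22, h2, c₂, sub_mul, sub_mul, one_mul, map_sub, mul_assoc,
    mul_assoc, h24, h2] at h1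
  omega

theorem existsUnique_theta_eq_homogSum (hB : IsPosDefEvenUnimodular B) {k : ℕ}
    (hL : Module.finrank ℤ L = 24 * k) :
    ∃! x : Fin (k + 1) → ℤ, x 0 = 1 ∧ theta B = homogSum c₄ Δ k x := by
  classical
  obtain ⟨U, V, hΔ, hUV⟩ := exists_Δ_eq_X_mul
  have hΔ0 : constantCoeff Δ = 0 := by simp [hΔ]
  obtain ⟨F, hF⟩ := exists_modularForm_theta hB (Module.Free.chooseBasis ℤ L) (k := k)
    ((Module.finrank_eq_card_chooseBasisIndex ℤ L).symm.trans hL)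
  obtain ⟨x, hx⟩ := exists_homogSum_eq hΔ hUV k (by push_cast; rfl) F hF
  refine ⟨x, ⟨?_, hx⟩, fun y hy =>
    homogSum_injective c₄_constantCoeff hΔ0 Δ_ne_zero k (hy.2.symm.trans hx)⟩
  rw [← constantCoeff_homogSum c₄_constantCoeff hΔ0 k x, ← hx, constantCoeff_theta hB]

theorem last_modEq_zero_of_theta_eq_homogSum (hB : IsPosDefEvenUnimodular B) {k : ℕ} (hk : 1 ≤ k)
    (hL : Module.finrank ℤ L = 24 * k) {x : Fin (k + 1) → ℤ}
    (hx : theta B = homogSum c₄ Δ k x) : x (Fin.last k) ≡ 0 [ZMOD 24] := by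
  obtain ⟨U, V, hΔ, hUV⟩ := exists_Δ_eq_X_mul
  have h1 := coeff_homogSum_mul_pow hUV k x
    (coeff_pow_mem_span_twentyFour hUV (hΔ ▸ qDeriv_Δ))
  rw [← hΔ, ← hx, Ideal.mem_span_singleton] at h1
  exact (Int.modEq_zero_iff_dvd).mpr
    ((dvd_sub_right (dvd_coeff_theta_mul_pow hB hk hL hΔ hUV)).mp h1)

end Congruence

end BorcherdsCongruence

end

theorem mainTheorem6 (k : ℕ) (hk : 1 ≤ k)
    (L : Type*) [AddCommGroup L] [Module.Free ℤ L] [Module.Finite ℤ L]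
    (hL : Module.finrank ℤ L = 24 * k)
    (B : LinearMap.BilinForm ℤ L) (hB : BorcherdsCongruence.IsPosDefEvenUnimodular B) :
    (∃! x : Fin (k + 1) → ℤ, x 0 = 1 ∧
      BorcherdsCongruence.theta B =
        ∑ i : Fin (k + 1), PowerSeries.C (x i) * BorcherdsCongruence.c₄ ^ (3 * (k - (i : ℕ))) *
          BorcherdsCongruence.Δ ^ (i : ℕ)) ∧
    ∀ x : Fin (k + 1) → ℤ, x 0 = 1 →
      BorcherdsCongruence.theta B =
        ∑ i : Fin (k + 1), PowerSeries.C (x i) * BorcherdsCongruence.c₄ ^ (3 * (k - (i : ℕ))) *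
          BorcherdsCongruence.Δ ^ (i : ℕ) →
      x (Fin.last k) ≡ 0 [ZMOD 24] :=
  ⟨BorcherdsCongruence.existsUnique_theta_eq_homogSum hB hL, fun _ _ hx =>
    BorcherdsCongruence.last_modEq_zero_of_theta_eq_homogSum hB hk hL hx⟩
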